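/- Work over an algebraically closed field of characteristic zero. A complete normal toric surface is described by its complete fan in $N_{\mathbb R}=\mathbb R^2$, $N=\mathbb Z^2$: torus-invariant curves $D_u$ correspond to primitive ray generators $u$, torus-fixed points (intersection points of two torus-invariant curves) to two-dimensional cones, and $D_u$, $D_v$ with $u\ne v$ meet if and only if $u,v$ span a cone of the fan. A toric log del Pezzo surface is a complete normal toric surface $S$ whose anticanonical divisor $-K_S$ is $\mathbb Q$-Cartier and ample (its singularities are automatically log terminal). Its minimal resolution $S'\to S$ is the smooth toric refinement of $S$ without exceptional $(-1)$-curves. $S$ is called basic if $D^2\ge -2$ for every torus-invariant curve $D$ on $S'$ that meets some $(-1)$-curve $C$ on $S'$ (such $C$ is torus-invariant). For an integer $n\ge 2$ let $S(std^1_n)$ be the smooth complete toric surface whose torus-invariant curves form a cycle with self-intersection numbers, in cyclic order, $(-n,\,0,\,n-1,\,-2,-1,-2)$; let $S(std^2_n)$ be the one with cycle $(-n,\,-2,-1,-2,\,n-2,\,-2,-1,-2)$; and let $S(3A_2)$ be the one with cycle $(-2,\,-2,-1,-2,\,-2,\,-1,-2,-2,-1)$. Theorem. Let $S$ be a toric log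 del Pezzo surface of Picard number one that is not basic, and let $S'$ be its minimal resolution. Then there is a surface $S_0$ which is $S(std^1_n)$ for some $n\ge 2$, or $S(std^2_n)$ for some $n\ge 2$, or $S(3A_2)$, and a finite sequence of toric blowups $$S'=S_t\to S_{t-1}\to\dots\to S_0,$$ in which each $S_{i+1}\to S_i$ is the blowup of $S_i$ at the intersection point of a $(-1)$-curve $C$ on $S_i$ with a torus-invariant curve $D$ on $S_i$ with $D^2\le -2$. -/

import Mathlib

/-- The determinant `det (u, v)` of two vectors of the lattice `N = ℤ²`. -/
def latticeDet (u v : ℤ × ℤ) : ℤ := u.1 * v.2 - u.2 * v.1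

/-- The duality pairing of a character `m ∈ M = ℤ²` with `u ∈ N = ℤ²`. -/
def latticePairing (m u : ℤ × ℤ) : ℤ := m.1 * u.1 + m.2 * u.2

/-- A complete normal toric surface, given by its complete fan in `N ⊗ ℝ = ℝ²`. A complete fan in
the plane is determined by the finite set of the primitive generators of its rays, its
two-dimensional cones being spanned by the consecutive rays; a finite set of primitive vectors
arises in this way iff it lies in no closed half-plane through the origin. A ray `u` is the
same thing as a torus-invariant curve `D_u` (an irreducible torus-invariant divisor). -/
@[ext]
structure CompleteToricSurface where
  /-- the primitive generators of the rays of the fan -/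
  rays : Finset (ℤ × ℤ)
  primitive : ∀ u ∈ rays, IsCoprime u.1 u.2
  complete : ∀ m : ℤ × ℤ, m ≠ 0 → ∃ u ∈ rays, 0 < latticePairing m u

namespace CompleteToricSurface

/-- `u`, `v` span a two-dimensional cone of the fan, and `v` follows `u` counterclockwise: the
angle from `u` to `v` is in `(0, π)` and no ray lies strictly between them. The two-dimensional
cones are the torus-fixed points of the surface. -/
def IsCone (S : CompleteToricSurface) (u v : S.rays) : Prop :=
  0 < latticeDet u v ∧ ∀ w : S.rays, ¬ (0 < latticeDet u w ∧ 0 < latticeDet w v)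

/-- The dual graph of the torus-invariant curves (without its weights): distinct torus-invariant
curves are adjacent iff they meet, that is, iff their rays span a cone of the fan. -/
def dualGraph (S : CompleteToricSurface) : SimpleGraph S.rays where
  Adj u v := S.IsCone u v ∨ S.IsCone v u
  symm := ⟨fun _ _ h => h.symm⟩
  loopless := ⟨fun u h => by
    have h0 : latticeDet u u = 0 := by unfold latticeDet; ring
    rcases h with h | h <;> exact absurd h.1 (by rw [h0]; exact lt_irrefl 0)⟩

/-- The surface is smooth: every two-dimensional cone is spanned by a basis of `ℤ²`. -/
def IsSmooth (S : CompleteToricSurface) : Prop :=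
  ∀ u v : S.rays, S.IsCone u v → latticeDet u v = 1

/-! ### Torus-invariant divisors, Picard number, log del Pezzo surfaces -/

/-- The torus-invariant Weil divisors `∑ a_u D_u`. -/
abbrev WeilDivisor (S : CompleteToricSurface) : Type := S.rays → ℤ

/-- The divisor `div (χ^m) = ∑ ⟨m, u⟩ D_u` of a character, as a linear map in `m`. -/
def divChar (S : CompleteToricSurface) : (ℤ × ℤ) →ₗ[ℤ] S.WeilDivisor where
  toFun m u := latticePairing m u
  map_add' m m' := by
    funext u; simp only [latticePairing, Pi.add_apply, Prod.fst_add, Prod.snd_add]; ring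
  map_smul' c m := by
    funext u
    simp only [latticePairing, Pi.smul_apply, Prod.smul_fst, Prod.smul_snd, smul_eq_mul,
      RingHom.id_apply]
    ring

/-- The torus-invariant Cartier divisors: on each affine chart of a two-dimensional cone the
divisor is the divisor of a character. -/
def cartierDivisors (S : CompleteToricSurface) : Submodule ℤ S.WeilDivisor where
  carrier := {D | ∀ u v : S.rays, S.IsCone u v → ∃ m : ℤ × ℤ, S.divChar m u = D u ∧
    S.divChar m v = D v}
  zero_mem' := fun u v _ => ⟨0, by simp, by simp⟩
  add_mem' := by
    intro D D' hD hD' u v h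
    obtain ⟨m, h1, h2⟩ := hD u v h
    obtain ⟨m', h1', h2'⟩ := hD' u v h
    exact ⟨m + m', by simp [h1, h1'], by simp [h2, h2']⟩
  smul_mem' := by
    intro c D hD u v h
    obtain ⟨m, h1, h2⟩ := hD u v h
    exact ⟨c • m, by simp only [map_smul, Pi.smul_apply, h1],
      by simp only [map_smul, Pi.smul_apply, h2]⟩

/-- The Picard group: torus-invariant Cartier divisors modulo the divisors of characters. -/
abbrev PicardGroup (S : CompleteToricSurface) : Type :=
  S.cartierDivisors ⧸ (LinearMap.range S.divChar).submoduleOf S.cartierDivisors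

/-- The Picard number, the rank of the Picard group. -/
noncomputable def picardNumber (S : CompleteToricSurface) : ℕ :=
  Module.finrank ℤ S.PicardGroup

/-- The divisor `D = ∑ a_u D_u` is Cartier and ample. On the chart of each two-dimensional cone
`σ`, `D` is the divisor of a character `χ^m`, with `m = m_σ`; ampleness (strict convexity of the
support function) says that `⟨m_σ, w⟩ < a_w` for the rays `w` not in `σ`. -/
def IsAmple (S : CompleteToricSurface) (D : S.WeilDivisor) : Prop :=
  ∀ u v : S.rays, S.IsCone u v → ∃ m : ℤ × ℤ, S.divChar m u = D u ∧ S.divChar m v = D v ∧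
    ∀ w : S.rays, w ≠ u → w ≠ v → S.divChar m w < D w

/-- The anticanonical divisor `-K = ∑ D_u`. -/
def anticanonical (S : CompleteToricSurface) : S.WeilDivisor := fun _ => 1

/-- A toric log del Pezzo surface: `-K` is an ample `ℚ`-Cartier divisor, that is, some positive
multiple of it is an ample Cartier divisor. (Toric surfaces have only cyclic quotient
singularities, so the singularities are automatically log terminal.) -/
def IsLogDelPezzo (S : CompleteToricSurface) : Prop :=
  ∃ k : ℕ, 0 < k ∧ S.IsAmple (k • S.anticanonical)

/-! ### Self-intersection numbers on smooth surfaces -/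

/-- A character with `⟨m, u⟩ = 1`, for primitive `u`. -/
def dualCharacter (u : ℤ × ℤ) : ℤ × ℤ := (Int.gcdA u.1 u.2, Int.gcdB u.1 u.2)

theorem latticePairing_dualCharacter {u : ℤ × ℤ} (hu : IsCoprime u.1 u.2) :
    latticePairing (dualCharacter u) u = 1 := by
  have h := Int.gcd_eq_gcd_ab u.1 u.2
  rw [Int.isCoprime_iff_gcd_eq_one.mp hu] at h
  simp only [latticePairing, dualCharacter]
  push_cast at h
  linarith

open Classical in
/-- The self-intersection number of the torus-invariant curve `D_u` on a smooth surface. With `m`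
a character such that `⟨m, u⟩ = 1`, the divisor `D_u` is linearly equivalent to
`D_u - div (χ^m) = - ∑_{v ≠ u} ⟨m, v⟩ D_v`, which is intersected with `D_u` using that distinct
torus-invariant curves meet transversally in one point or are disjoint. -/
noncomputable def selfInt (S : CompleteToricSurface) (u : S.rays) : ℤ :=
  - ∑ v : S.rays, if S.dualGraph.Adj u v then S.divChar (dualCharacter u) v else 0

/-! ### Minimal resolutions and basic surfaces -/

/-- `S'` is the minimal resolution of `S`: the fan of `S'` is a smooth refinement of the fan of
`S` (a complete fan in the plane refines another one iff it has all its rays), and no exceptional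
curve, that is, no curve of a ray which is not in the fan of `S`, is a `(-1)`-curve. -/
def IsMinimalResolution (S' S : CompleteToricSurface) : Prop :=
  S'.IsSmooth ∧ S.rays ⊆ S'.rays ∧ ∀ u : S'.rays, (u : ℤ × ℤ) ∉ S.rays → S'.selfInt u ≠ -1

/-- `S` is basic: on the minimal resolution, every torus-invariant curve `D` that meets a
`(-1)`-curve `C` has `D² ≥ -2`. (A `(-1)`-curve on a smooth complete toric surface is
torus-invariant.) -/
def IsBasic (S : CompleteToricSurface) : Prop :=
  ∃ S' : CompleteToricSurface, S'.IsMinimalResolution S ∧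
    ∀ C D : S'.rays, S'.selfInt C = -1 → S'.dualGraph.Adj C D → -2 ≤ S'.selfInt D

/-! ### Surfaces with a given dual graph -/

/-- The dual graph of the torus-invariant curves is the cycle with weights `l`, in this cyclic
order: the curves are numbered so that the `i`-th curve has self-intersection number `l[i]`, and
exactly the cyclically consecutive curves meet. -/
def HasDualCycle (S : CompleteToricSurface) (l : List ℤ) : Prop :=
  ∃ e : SimpleGraph.cycleGraph l.length ≃g S.dualGraph,
    ∀ i : Fin l.length, S.selfInt (e i) = l.get i

/-- `S` is the surface `[[a, F, b, G]]`: the smooth toric surface with a `ℙ¹`-fibration whose two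
torus-invariant sections have self-intersection numbers `a` and `b` and whose two torus-invariant
fibers are the chains of curves with self-intersection numbers `F` and `G`. -/
def IsFibered (S : CompleteToricSurface) (a : ℤ) (F : List ℤ) (b : ℤ) (G : List ℤ) : Prop :=
  S.IsSmooth ∧ S.HasDualCycle (a :: F ++ b :: G)

/-- The smooth fiber `F₀`. -/
def smoothFiber : List ℤ := [0]

/-- The singular fiber of type `I₀`. -/
def fiberTypeOne : List ℤ := [-2, -1, -2]

/-- The singular fiber of type `II₀`. -/
def fiberTypeTwo : List ℤ := [-1, -2, -2, -1]

/-- `S` is `S(std¹ₙ) = [[-n, F₀, n - 1, F₁⁰]]`. -/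
def IsStdOne (n : ℤ) (S : CompleteToricSurface) : Prop :=
  S.IsFibered (-n) smoothFiber (n - 1) fiberTypeOne

/-- `S` is `S(std²ₙ) = [[-n, F₁⁰, n - 2, F₁⁰]]`. -/
def IsStdTwo (n : ℤ) (S : CompleteToricSurface) : Prop :=
  S.IsFibered (-n) fiberTypeOne (n - 2) fiberTypeOne

/-- `S` is `S(3A₂) = [[-2, F₁⁰, -2, F₂⁰]]`. -/
def IsThreeATwo (S : CompleteToricSurface) : Prop :=
  S.IsFibered (-2) fiberTypeOne (-2) fiberTypeTwo

/-! ### Toric blowups -/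

/-- `T` is the blowup of the smooth toric surface `S` in the intersection point of the
torus-invariant curves `C` and `D`: the cone spanned by the two rays is subdivided by their sum. -/
def IsToricBlowup (S : CompleteToricSurface) (C D : S.rays) (T : CompleteToricSurface) : Prop :=
  S.IsSmooth ∧ S.dualGraph.Adj C D ∧ T.rays = insert ((C : ℤ × ℤ) + (D : ℤ × ℤ)) S.rays

/-- `T` is a toric blowup of `S` in the intersection point of a `(-1)`-curve `C` and a
torus-invariant curve `D` with `D² ≤ -2`. -/
def InverseCascadeStep (S T : CompleteToricSurface) : Prop :=
  ∃ C D : S.rays, S.selfInt C = -1 ∧ S.selfInt D ≤ -2 ∧ S.IsToricBlowup C D T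

end CompleteToricSurface

/-!
The minimal resolution `S'` of a toric log del Pezzo surface `S` of Picard number one is a smooth
complete toric surface with at most three *free* curves, that is, torus-invariant curves with
self-intersection number at least `-1`: the fan of `S` has at most three rays
(`card_rays_le_of_picardNumber`), and an exceptional curve has self-intersection number at most
`-2` (`IsMinimalResolution.selfInt_le`). Everything else follows from this bound, without further
use of ampleness.

Suppose that such a surface has a `(-1)`-curve which meets a curve `D` with `D² ≤ -2`; for a
surface that is not basic there is even one with `D² ≤ -3`. If some `(-1)`-curve `C` lies between
a `(-2)`-curve `E` and a curve `D` with `D² ≤ -3`, contract `C`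
(`exists_inverseCascadeStep`). Now `E` is a `(-1)`-curve, which meets `D`, whose self-intersection
number is still at most `-2`; the number of free curves did not increase; and blowing up `E ∩ D`
is a step of the inverse cascade. By induction on the number of rays, it remains to see that a
surface without such a `C` is standard (`CyclicFan.isCycle_of_notContractible`).

For this, number the rays `f i` counterclockwise by `i ∈ ℤ`, periodically, so that
`f (i - 1) + f (i + 1) = -a i • f i` with the self-intersection numbers `a i`. For a fixed vector
`w` the numbers `x i = det (w, f i)` satisfy the same recurrence. Once `0 ≤ x (i - 1) ≤ x i` and
`0 < x i`, the sequence keeps growing as long as `a ≤ -2`, and also across a `-1` between two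
numbers `≤ -3` (`Growing.run`, `Growing.jump`). But the rays go around the origin, hence the growth
must be stopped by one of the three free curves.

* If there is a chain `-2, -1, -2`, it is a fiber of a `ℙ¹`-fibration. The rays of the two
  adjacent sections are opposite, and the remaining rays make up a second fiber, which contains one
  or two free curves. The growth of `det (w, ·)`, with `w` the ray of a section, leaves for the
  second fiber only `0`; `-2, -1, -2`; and `-1, -2, -2, -1` with two sections of self-intersection
  `-2` (`FiberedFan.isCycle`).
* If there is no such chain, consider a `(-1)`-curve with a neighbor `≤ -2`. Either the other
  neighbor is a free curve, which `CyclicFan.not_free_neighbor` excludes, or both neighbors are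
  `≤ -3`, which `CyclicFan.not_neighbors_le` excludes.
-/

/-! ### Determinants of lattice vectors -/

theorem latticeDet_swap (u v : ℤ × ℤ) : latticeDet v u = -latticeDet u v := by
  unfold latticeDet; ring

@[simp]
theorem latticeDet_self (u : ℤ × ℤ) : latticeDet u u = 0 := by
  unfold latticeDet; ring

@[simp]
theorem latticeDet_neg_left (u v : ℤ × ℤ) : latticeDet (-u) v = -latticeDet u v := by
  simp only [latticeDet, Prod.fst_neg, Prod.snd_neg]; ring

@[simp]
theorem latticeDet_neg_right (u v : ℤ × ℤ) : latticeDet u (-v) = -latticeDet u v := by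
  simp only [latticeDet, Prod.fst_neg, Prod.snd_neg]; ring

theorem latticeDet_add_right (u v v' : ℤ × ℤ) :
    latticeDet u (v + v') = latticeDet u v + latticeDet u v' := by
  simp only [latticeDet, Prod.fst_add, Prod.snd_add]; ring

theorem latticeDet_smul_right (c : ℤ) (u v : ℤ × ℤ) :
    latticeDet u (c • v) = c * latticeDet u v := by
  simp only [latticeDet, Prod.smul_fst, Prod.smul_snd, smul_eq_mul]; ring

/-- The Plücker relation. -/
theorem latticeDet_plucker (u a b c : ℤ × ℤ) :
    latticeDet u b * latticeDet a c =
      latticeDet u a * latticeDet b c + latticeDet u c * latticeDet a b := by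
  unfold latticeDet; ring

/-- On an open half-plane bounded by the line of `u`, the counterclockwise order is transitive. -/
theorem latticeDet_pos_trans {u a b c : ℤ × ℤ} (ha : 0 ≤ latticeDet u a)
    (hb : 0 < latticeDet u b) (hc : 0 < latticeDet u c) (hab : 0 < latticeDet a b)
    (hbc : 0 ≤ latticeDet b c) : 0 < latticeDet a c := by
  have h := latticeDet_plucker u a b c
  have : 0 < latticeDet u b * latticeDet a c := by
    rw [h]; exact add_pos_of_nonneg_of_pos (mul_nonneg ha hbc) (mul_pos hc hab)
  exact pos_of_mul_pos_right this hb.le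

/-- A vector strictly between `a` and `w`, where `w` is in the open half-plane on the left of `u`
and `a` is strictly between `u` and `w`, is itself on the left of `u`. -/
theorem latticeDet_pos_of_between {u a b w : ℤ × ℤ} (ha : 0 < latticeDet u a)
    (hw : 0 ≤ latticeDet u w) (haw : 0 < latticeDet a w) (hab : 0 < latticeDet a b)
    (hbw : 0 < latticeDet b w) : 0 < latticeDet u b := by
  have h := latticeDet_plucker u a b w
  have : 0 < latticeDet u b * latticeDet a w := by
    rw [h]; exact add_pos_of_pos_of_nonneg (mul_pos ha hbw) (mul_nonneg hw hab.le)
  exact pos_of_mul_pos_left this haw.le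

theorem exists_smul_of_latticeDet_eq_zero {a b : ℤ × ℤ} (ha : IsCoprime a.1 a.2)
    (h : latticeDet a b = 0) : ∃ t : ℤ, b = t • a := by
  obtain ⟨r, s, hrs⟩ := ha
  unfold latticeDet at h
  refine ⟨r * b.1 + s * b.2, ?_⟩
  ext
  · simp only [Prod.smul_fst, smul_eq_mul]; linear_combination (-b.1) * hrs - s * h
  · simp only [Prod.smul_snd, smul_eq_mul]; linear_combination (-b.2) * hrs + r * h

theorem eq_or_eq_neg_of_latticeDet_eq_zero {a b : ℤ × ℤ} (ha : IsCoprime a.1 a.2)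
    (hb : IsCoprime b.1 b.2) (h : latticeDet a b = 0) : b = a ∨ b = -a := by
  obtain ⟨t, rfl⟩ := exists_smul_of_latticeDet_eq_zero ha h
  obtain ⟨r, s, hrs⟩ := hb
  simp only [Prod.smul_fst, Prod.smul_snd, smul_eq_mul] at hrs
  have ht : IsUnit t := IsUnit.of_mul_eq_one (r * a.1 + s * a.2) (by linear_combination hrs)
  rcases Int.isUnit_iff.mp ht with rfl | rfl <;> simp

theorem eq_of_latticeDet_eq_zero {u a b : ℤ × ℤ} (ha : IsCoprime a.1 a.2)
    (hb : IsCoprime b.1 b.2) (h : latticeDet a b = 0) (hua : 0 < latticeDet u a)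
    (hub : 0 < latticeDet u b) : b = a := by
  rcases eq_or_eq_neg_of_latticeDet_eq_zero ha hb h with h | h
  · exact h
  · rw [h, latticeDet_neg_right] at hub; omega

namespace CompleteToricSurface

variable {S : CompleteToricSurface}

theorem isCoprime_ray (u : S.rays) : IsCoprime (u : ℤ × ℤ).1 (u : ℤ × ℤ).2 := S.primitive u u.2

/-- Every open half-plane contains a ray. -/
theorem exists_latticeDet_pos {u : ℤ × ℤ} (hu : u ≠ 0) :
    ∃ v : S.rays, 0 < latticeDet u v := by
  obtain ⟨v, hv, h⟩ := S.complete (-u.2, u.1) (by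
    intro h
    simp only [Prod.mk_eq_zero, neg_eq_zero] at h
    exact hu (Prod.ext h.2 h.1))
  refine ⟨⟨v, hv⟩, ?_⟩
  simp only [latticePairing] at h
  simp only [latticeDet]
  linarith

theorem ray_ne_zero (u : S.rays) : (u : ℤ × ℤ) ≠ 0 := by
  intro h
  have := isCoprime_ray u
  rw [h] at this
  exact not_isCoprime_zero_zero this

open Classical in
/-- The rays strictly between `u` and `v`, for an angle from `u` to `v` in `(0, π)`. -/
noncomputable def between (S : CompleteToricSurface) (u v : ℤ × ℤ) : Finset S.rays :=
  Finset.univ.filter fun w => 0 < latticeDet u w ∧ 0 < latticeDet w v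

theorem mem_between {u v : ℤ × ℤ} {w : S.rays} :
    w ∈ S.between u v ↔ 0 < latticeDet u w ∧ 0 < latticeDet w v := by
  simp [between]

/-! ### The cyclic order of the rays -/

theorem exists_isCone (u : S.rays) : ∃ v : S.rays, S.IsCone u v := by
  classical
  obtain ⟨v₀, hv₀⟩ := exists_latticeDet_pos (S := S) (ray_ne_zero u)
  obtain ⟨v, hv, hmin⟩ := Finset.exists_min_image
    (Finset.univ.filter fun v : S.rays => 0 < latticeDet u v) (fun v => (S.between u v).card)
    ⟨v₀, by simpa using hv₀⟩
  simp only [Finset.mem_filter, Finset.mem_univ, true_and] at hv hmin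
  refine ⟨v, hv, fun w hw => ?_⟩
  refine absurd (hmin w hw.1) (not_le.mpr (Finset.card_lt_card ?_))
  refine Finset.ssubset_iff_of_subset (fun x hx => ?_) |>.mpr ⟨w, mem_between.mpr hw, ?_⟩
  · rw [mem_between] at hx ⊢
    exact ⟨hx.1, latticeDet_pos_trans hx.1.le hw.1 hv hx.2 hw.2.le⟩
  · simp [mem_between]

theorem IsCone.right_unique {u v v' : S.rays} (h : S.IsCone u v) (h' : S.IsCone u v') :
    v = v' := by
  have h1 := h.2 v'
  have h2 := h'.2 v
  have := latticeDet_swap v v'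
  refine (Subtype.ext
    (eq_of_latticeDet_eq_zero (isCoprime_ray v) (isCoprime_ray v') ?_ h.1 h'.1)).symm
  have := h.1
  have := h'.1
  have : ¬ 0 < latticeDet v' v := fun hh => h1 ⟨h'.1, hh⟩
  have : ¬ 0 < latticeDet v v' := fun hh => h2 ⟨h.1, hh⟩
  omega

theorem IsCone.left_unique {u u' v : S.rays} (h : S.IsCone u v) (h' : S.IsCone u' v) :
    u = u' := by
  have h1 := h.2 u'
  have h2 := h'.2 u
  have := latticeDet_swap u u'
  have e1 := latticeDet_swap u v
  have e2 := latticeDet_swap u' v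
  have := h.1
  have := h'.1
  have : ¬ 0 < latticeDet u' u := fun hh => h2 ⟨hh, h.1⟩
  have : ¬ 0 < latticeDet u u' := fun hh => h1 ⟨hh, h'.1⟩
  refine (Subtype.ext
    (eq_of_latticeDet_eq_zero (u := -v) (isCoprime_ray u) (isCoprime_ray u') ?_ ?_ ?_)).symm
  · omega
  · rw [latticeDet_neg_left]; omega
  · rw [latticeDet_neg_left]; omega

/-- The counterclockwise next ray. -/
noncomputable def next (u : S.rays) : S.rays := (exists_isCone u).choose

theorem isCone_next (u : S.rays) : S.IsCone u (next u) := (exists_isCone u).choose_spec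

theorem isCone_iff_next {u v : S.rays} : S.IsCone u v ↔ next u = v :=
  ⟨fun h => (isCone_next u).right_unique h, fun h => h ▸ isCone_next u⟩

/-- The counterclockwise rotation of the rays by one place. -/
noncomputable def rotation (S : CompleteToricSurface) : Equiv.Perm S.rays :=
  Equiv.ofBijective next (Finite.injective_iff_bijective.mp fun u u' h =>
    (isCone_next u).left_unique (h ▸ isCone_next u'))

theorem rotation_apply (u : S.rays) : S.rotation u = next u := rfl

/-- If the angle from `u` to `w` is in `(0, π)`, then rotating `u` leads to `w` through rays
between `u` and `w` only. -/
theorem exists_rotation_pow (u w : S.rays) (h : 0 < latticeDet u w) :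
    ∃ i : ℕ, 0 < i ∧ (S.rotation ^ i) u = w ∧ ∀ j, 0 < j → j < i →
      0 < latticeDet u ((S.rotation ^ j) u) ∧ 0 < latticeDet ((S.rotation ^ j) u) w := by
  induction hN : (S.between u w).card using Nat.strong_induction_on generalizing u with
  | _ N ih =>
    have hv := isCone_next u
    set v := next u with hvdef
    by_cases hvw : v = w
    · exact ⟨1, one_pos, by rw [pow_one, rotation_apply, ← hvdef, hvw], by omega⟩
    have hvw' : 0 < latticeDet v w := by
      by_contra hc
      have e := latticeDet_swap v w
      have h2 : ¬ 0 < latticeDet w v := fun hh => hv.2 w ⟨h, hh⟩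
      exact hvw (Subtype.ext
        (eq_of_latticeDet_eq_zero (isCoprime_ray v) (isCoprime_ray w) (by omega) hv.1 h)).symm
    have hlt : (S.between v w).card < N := by
      rw [← hN]
      refine Finset.card_lt_card (Finset.ssubset_iff_of_subset (fun x hx => ?_) |>.mpr
        ⟨v, mem_between.mpr ⟨hv.1, hvw'⟩, by simp [mem_between]⟩)
      rw [mem_between] at hx ⊢
      exact ⟨latticeDet_pos_of_between hv.1 h.le hvw' hx.1 hx.2, hx.2⟩
    obtain ⟨i, hi0, hi, hj⟩ := ih _ hlt v hvw' rfl
    refine ⟨i + 1, by omega, by rw [pow_succ, Equiv.Perm.mul_apply]; exact hi, ?_⟩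
    intro j hj0 hji
    obtain ⟨k, rfl⟩ : ∃ k, j = k + 1 := ⟨j - 1, by omega⟩
    rw [pow_succ, Equiv.Perm.mul_apply, rotation_apply, ← hvdef]
    rcases Nat.eq_zero_or_pos k with rfl | hk
    · exact ⟨hv.1, hvw'⟩
    · obtain ⟨h1, h2⟩ := hj k hk (by omega)
      exact ⟨latticeDet_pos_of_between hv.1 h.le hvw' h1 h2, h2⟩

/-- The analogue of `exists_rotation_pow` for an angle equal to `π`. -/
theorem exists_rotation_pow_of_eq_neg (u w : S.rays) (h : (w : ℤ × ℤ) = -u) :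
    ∃ i : ℕ, 0 < i ∧ (S.rotation ^ i) u = w ∧ ∀ j, 0 < j → j < i →
      0 < latticeDet u ((S.rotation ^ j) u) ∧ 0 < latticeDet ((S.rotation ^ j) u) w := by
  have hv := (isCone_next u).1
  have hvw : 0 < latticeDet (next u) w := by
    rw [h, latticeDet_neg_right, ← latticeDet_swap]; exact hv
  obtain ⟨i, hi0, hi, hj⟩ := exists_rotation_pow _ _ hvw
  refine ⟨i + 1, by omega, by rw [pow_succ, Equiv.Perm.mul_apply]; exact hi, ?_⟩
  intro j hj0 hji
  have key : 0 < latticeDet ((S.rotation ^ j) u) w := by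
    obtain ⟨k, rfl⟩ : ∃ k, j = k + 1 := ⟨j - 1, by omega⟩
    rw [pow_succ, Equiv.Perm.mul_apply, rotation_apply]
    rcases Nat.eq_zero_or_pos k with rfl | hk
    · exact hvw
    · exact (hj k hk (by omega)).2
  refine ⟨?_, key⟩
  rwa [h, latticeDet_neg_right, ← latticeDet_swap] at key

theorem sameCycle_rotation (u w : S.rays) : S.rotation.SameCycle u w := by
  have key : ∀ u w : S.rays, 0 < latticeDet u w → S.rotation.SameCycle u w := by
    intro u w h
    obtain ⟨i, -, hi, -⟩ := exists_rotation_pow u w h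
    exact ⟨i, by simpa using hi⟩
  rcases lt_trichotomy (latticeDet u w) 0 with h | h | h
  · exact (key w u (by rw [latticeDet_swap]; omega)).symm
  · rcases eq_or_eq_neg_of_latticeDet_eq_zero (isCoprime_ray u) (isCoprime_ray w) h with h | h
    · rw [Subtype.ext h]
    · obtain ⟨i, -, hi, -⟩ := exists_rotation_pow_of_eq_neg u w h
      exact ⟨i, by simpa using hi⟩
  · exact key u w h

theorem isCycleOn_rotation : S.rotation.IsCycleOn (Finset.univ : Finset S.rays) :=
  ⟨by rw [Finset.coe_univ]; exact Set.bijOn_univ.mpr S.rotation.bijective,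
    fun u _ w _ => sameCycle_rotation u w⟩

/-! ### Self-intersection numbers -/

theorem IsCone.sum_eq (hS : S.IsSmooth) {p u q : S.rays} (hp : S.IsCone p u)
    (hq : S.IsCone u q) : (p : ℤ × ℤ) + q = (-S.selfInt u) • (u : ℤ × ℤ) := by
  classical
  have hpu := hS p u hp
  have huq := hS u q hq
  have hne : p ≠ q := by
    rintro rfl
    have := latticeDet_swap (u : ℤ × ℤ) p
    omega
  obtain ⟨t, ht⟩ := exists_smul_of_latticeDet_eq_zero (a := u) (b := (p : ℤ × ℤ) + q)
    (isCoprime_ray u) (by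
    rw [latticeDet_add_right, latticeDet_swap (p : ℤ × ℤ) u]; omega)
  have hadj : ∀ v : S.rays, S.dualGraph.Adj u v ↔ v = p ∨ v = q := by
    intro v
    change S.IsCone u v ∨ S.IsCone v u ↔ _
    constructor
    · rintro (h | h)
      · exact Or.inr (h.right_unique hq)
      · exact Or.inl (h.left_unique hp)
    · rintro (rfl | rfl)
      · exact Or.inr hp
      · exact Or.inl hq
  have hsum : S.selfInt u = -(S.divChar (dualCharacter u) p + S.divChar (dualCharacter u) q) := by
    unfold selfInt
    simp only [hadj]
    rw [← Finset.sum_filter, Finset.filter_or, Finset.filter_eq', Finset.filter_eq']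
    simp only [Finset.mem_univ, if_true]
    rw [Finset.sum_union (by simpa using hne), Finset.sum_singleton, Finset.sum_singleton]
  have hpair : S.divChar (dualCharacter u) p + S.divChar (dualCharacter u) q = t := by
    have h1 := latticePairing_dualCharacter (isCoprime_ray u)
    have e1 := congrArg Prod.fst ht
    have e2 := congrArg Prod.snd ht
    simp only [Prod.fst_add, Prod.snd_add, Prod.smul_fst, Prod.smul_snd, smul_eq_mul] at e1 e2
    simp only [divChar, LinearMap.coe_mk, AddHom.coe_mk, latticePairing] at h1 ⊢
    linear_combination t * h1 + (dualCharacter u).1 * e1 + (dualCharacter u).2 * e2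
  rw [hsum, hpair, neg_neg, ht]

theorem IsCone.selfInt_eq (hS : S.IsSmooth) {p u q : S.rays} (hp : S.IsCone p u)
    (hq : S.IsCone u q) {c : ℤ} (h : (p : ℤ × ℤ) + q = (-c) • (u : ℤ × ℤ)) :
    S.selfInt u = c := by
  have h1 := IsCone.sum_eq hS hp hq
  rw [h] at h1
  have h2 : (-c) * latticeDet p u = (-S.selfInt u) * latticeDet p u := by
    rw [← latticeDet_smul_right, ← latticeDet_smul_right, h1]
  rw [hS p u hp] at h2
  omega

end CompleteToricSurface

/-! ### Cyclic sequences of lattice vectors -/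

/-- The rays `f i` of a smooth complete fan with `n` rays, in counterclockwise order and repeated
with period `n`, and the self-intersection numbers `a i` of their curves. That the sequence winds
around the origin only once per period is the condition `between`: if the angle from `f i` to
`f k` is at most `π`, then the rays between them lie in that angle. -/
structure CyclicFan (n : ℕ) (f : ℤ → ℤ × ℤ) (a : ℤ → ℤ) : Prop where
  pos : 0 < n
  det_one : ∀ i, latticeDet (f i) (f (i + 1)) = 1
  sum_eq : ∀ i, f (i - 1) + f (i + 1) = (-a i) • f i
  periodic : ∀ i : ℤ, f (i + n) = f i
  periodic_selfInt : ∀ i : ℤ, a (i + n) = a i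
  between : ∀ i j k : ℤ, i < j → j < k → k < i + n → (0 < latticeDet (f i) (f k) ∨ f k = -f i) →
    0 < latticeDet (f i) (f j) ∧ 0 < latticeDet (f j) (f k)

/-- Among the numbers of a period, at most three are `≥ -1`; the curves with such numbers are called
free. -/
def AtMostThreeFree (n : ℕ) (a : ℤ → ℤ) : Prop :=
  ∀ i j k l : ℤ, i < j → j < k → k < l → l < i + n →
    -1 ≤ a i → -1 ≤ a j → -1 ≤ a k → -1 ≤ a l → False

/-- No `-1` has a neighbor `-2` on one side and a neighbor `≤ -3` on the other side, so that
there is no curve to be contracted. -/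
def NotContractible (a : ℤ → ℤ) : Prop :=
  ∀ i, a i = -1 → (a (i - 1) = -2 → -2 ≤ a (i + 1)) ∧ (a (i + 1) = -2 → -2 ≤ a (i - 1))

/-- A period of the sequence is the list `l`, from some position on, in one of the two
directions. -/
def IsCycleOf (n : ℕ) (a : ℤ → ℤ) (l : List ℤ) : Prop :=
  n = l.length ∧ ∃ c ε : ℤ, (ε = 1 ∨ ε = -1) ∧ ∀ i : Fin l.length, a (c + ε * i) = l.get i

/-- The dual cycle of one of the surfaces `S(std¹ₘ)`, `S(std²ₘ)`, `S(3A₂)`. -/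
def IsStandardCycle (l : List ℤ) : Prop :=
  (∃ m : ℤ, 2 ≤ m ∧ l = [-m, 0, m - 1, -2, -1, -2]) ∨
  (∃ m : ℤ, 2 ≤ m ∧ l = [-m, -2, -1, -2, m - 2, -2, -1, -2]) ∨
  l = [-2, -2, -1, -2, -2, -1, -2, -2, -1]

section Reflection

variable {n : ℕ} {f : ℤ → ℤ × ℤ} {a : ℤ → ℤ}

theorem CyclicFan.shift (h : CyclicFan n f a) (c : ℤ) :
    CyclicFan n (fun i => f (c + i)) (fun i => a (c + i)) where
  pos := h.pos
  det_one i := by have := h.det_one (c + i); rwa [add_assoc] at this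
  sum_eq i := by
    have := h.sum_eq (c + i)
    rwa [add_assoc, add_sub_assoc] at this
  periodic i := by rw [← add_assoc]; exact h.periodic _
  periodic_selfInt i := by rw [← add_assoc]; exact h.periodic_selfInt _
  between i j k h1 h2 h3 h4 :=
    h.between (c + i) (c + j) (c + k) (by omega) (by omega) (by omega) h4

theorem latticeDet_prodSwap (u v : ℤ × ℤ) : latticeDet u.swap v.swap = latticeDet v u := by
  simp only [latticeDet, Prod.fst_swap, Prod.snd_swap]; ring

/-- The reflected fan. -/
theorem CyclicFan.reflect (h : CyclicFan n f a) :
    CyclicFan n (fun i : ℤ => (f (-i)).swap) (fun i : ℤ => a (-i)) where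
  pos := h.pos
  det_one i := by
    have := h.det_one (-(i + 1))
    rw [show -(i + 1) + 1 = -i by ring] at this
    rw [latticeDet_prodSwap, this]
  sum_eq i := by
    have := h.sum_eq (-i)
    rw [show -(i - 1) = -i + 1 by ring, show -(i + 1) = -i - 1 by ring, ← Prod.swap_add, add_comm,
      this, Prod.smul_swap]
  periodic i := by
    have := h.periodic (-(i + n))
    rw [show -(i + n) + n = -i by ring] at this
    rw [this]
  periodic_selfInt i := by
    have := h.periodic_selfInt (-(i + n))
    rw [show -(i + n) + n = -i by ring] at this
    rw [this]
  between i j k h1 h2 h3 h4 := by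
    simp only [latticeDet_prodSwap] at h4 ⊢
    refine (h.between (-k) (-j) (-i) (by omega) (by omega) (by omega) ?_).symm
    refine h4.imp id fun h5 => ?_
    have := congrArg Prod.swap h5
    rw [Prod.swap_swap, Prod.swap_neg, Prod.swap_swap] at this
    rw [this, neg_neg]

theorem AtMostThreeFree.shift (h : AtMostThreeFree n a) (c : ℤ) :
    AtMostThreeFree n (fun i => a (c + i)) :=
  fun i j k l h1 h2 h3 h4 =>
    h (c + i) (c + j) (c + k) (c + l) (by omega) (by omega) (by omega) (by omega)

theorem AtMostThreeFree.reflect (h : AtMostThreeFree n a) :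
    AtMostThreeFree n (fun i : ℤ => a (-i)) :=
  fun i j k l h1 h2 h3 h4 hi hj hk hl =>
    h (-l) (-k) (-j) (-i) (by omega) (by omega) (by omega) (by omega) hl hk hj hi

theorem NotContractible.shift (h : NotContractible a) (c : ℤ) :
    NotContractible (fun i => a (c + i)) := by
  intro i hi
  have := h (c + i) hi
  rwa [add_assoc, add_sub_assoc] at this

theorem NotContractible.reflect (h : NotContractible a) :
    NotContractible (fun i : ℤ => a (-i)) := by
  intro i hi
  have := h (-i) hi
  simp only [show -(i - 1) = -i + 1 by ring, show -(i + 1) = -i - 1 by ring]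
  exact this.symm

theorem IsCycleOf.of_shift {l : List ℤ} {c : ℤ} (h : IsCycleOf n (fun i => a (c + i)) l) :
    IsCycleOf n a l := by
  obtain ⟨h1, c', ε, hε, h2⟩ := h
  exact ⟨h1, c + c', ε, hε, fun i => by rw [← h2 i, add_assoc]⟩

end Reflection

/-! ### Growth of determinants along the sequence -/

section Growth

variable {x a : ℤ → ℤ}

/-- The determinants of the rays of a fan with a fixed vector satisfy this recurrence. -/
def IsHeight (x a : ℤ → ℤ) : Prop := ∀ i, x (i - 1) + x (i + 1) = -a i * x i

/-- The heights `x` do not decrease from `i - 1` to `i`, where they are positive. -/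
def Growing (x : ℤ → ℤ) (i : ℤ) : Prop := 0 ≤ x (i - 1) ∧ x (i - 1) ≤ x i ∧ 0 < x i

theorem IsHeight.succ (h : IsHeight x a) (i : ℤ) : x (i + 1) = -a i * x i - x (i - 1) := by
  have := h i; omega

theorem IsHeight.neg (h : IsHeight x a) : IsHeight (fun i => -x i) a := fun i => by
  have := h i
  linear_combination -this

theorem IsHeight.reflect (h : IsHeight x a) : IsHeight (fun i => x (-i)) (fun i : ℤ => a (-i)) := by
  intro i
  have := h (-i)
  simp only [show -(i - 1) = -i + 1 by ring, show -(i + 1) = -i - 1 by ring]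
  linear_combination this

theorem CyclicFan.isHeight {n : ℕ} {f : ℤ → ℤ × ℤ} (h : CyclicFan n f a) (w : ℤ × ℤ) :
    IsHeight (fun i => latticeDet w (f i)) a := fun i => by
  rw [← latticeDet_add_right, h.sum_eq, latticeDet_smul_right]

theorem Growing.succ (h : IsHeight x a) {i : ℤ} (hi : Growing x i) (ha : a i ≤ -2) :
    Growing x (i + 1) := by
  obtain ⟨h0, h1, h2⟩ := hi
  have := h.succ i
  unfold Growing
  rw [add_sub_cancel_right, this]
  refine ⟨h2.le, ?_, ?_⟩ <;> nlinarith

theorem Growing.run (h : IsHeight x a) {i k : ℤ} (hik : i ≤ k) (hi : Growing x i)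
    (ha : ∀ j, i ≤ j → j < k → a j ≤ -2) : Growing x k := by
  induction k, hik using Int.leInduction with
  | base => exact hi
  | succ k hk ih =>
    exact (ih fun j h1 h2 => ha j h1 (by omega)).succ h (ha k hk (by omega))

/-- Heights keep growing across a `-1` between two numbers `≤ -3`. -/
theorem Growing.jump (h : IsHeight x a) {i : ℤ} (hi : Growing x i) (ha : a i ≤ -3)
    (ha1 : a (i + 1) = -1) :
    0 < x (i + 1) ∧ 0 < x (i + 2) ∧ (a (i + 2) ≤ -3 → Growing x (i + 3)) := by
  obtain ⟨h0, h1, h2⟩ := hi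
  have e1 := h.succ i
  have e2 := h.succ (i + 1)
  have e3 := h.succ (i + 2)
  rw [ha1, add_sub_cancel_right, show i + 1 + 1 = i + 2 by ring] at e2
  rw [show i + 2 + 1 = i + 3 by ring, show i + 2 - 1 = i + 1 by ring] at e3
  have g1 : 2 * x i ≤ x (i + 1) := by nlinarith
  refine ⟨by omega, by omega, fun ha2 => ?_⟩
  have g3 : 3 * x (i + 2) - x (i + 1) ≤ x (i + 3) := by nlinarith
  unfold Growing
  rw [show i + 3 - 1 = i + 2 by ring]
  omega

/-- Heights keep growing across `-1, t, -1` between two numbers `≤ -3`, if `t ≤ -4`. -/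
theorem Growing.double_jump (h : IsHeight x a) {i : ℤ} (hi : Growing x i) (ha : a i ≤ -3)
    (ha1 : a (i + 1) = -1) (ha2 : a (i + 2) ≤ -4) (ha3 : a (i + 3) = -1) (ha4 : a (i + 4) ≤ -3) :
    Growing x (i + 5) := by
  obtain ⟨h0, h1, h2⟩ := hi
  have e1 := h.succ i
  have e2 := h.succ (i + 1)
  have e3 := h.succ (i + 2)
  have e4 := h.succ (i + 3)
  have e5 := h.succ (i + 4)
  rw [ha1, add_sub_cancel_right, show i + 1 + 1 = i + 2 by ring] at e2
  rw [show i + 2 + 1 = i + 3 by ring, show i + 2 - 1 = i + 1 by ring] at e3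
  rw [ha3, show i + 3 + 1 = i + 4 by ring, show i + 3 - 1 = i + 2 by ring] at e4
  rw [show i + 4 + 1 = i + 5 by ring, show i + 4 - 1 = i + 3 by ring] at e5
  have g1 : 2 * x i ≤ x (i + 1) := by nlinarith
  have g3 : 4 * x (i + 2) - x (i + 1) ≤ x (i + 3) := by nlinarith
  have g5 : 3 * x (i + 4) - x (i + 3) ≤ x (i + 5) := by nlinarith
  unfold Growing
  rw [show i + 5 - 1 = i + 4 by ring]
  omega

/-- Heights stay positive along numbers `≤ -2` with a single exception, a `-1` between two numbers
`≤ -3`. -/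
theorem Growing.pos_through (h : IsHeight x a) {i p k : ℤ} (hi : Growing x i) (hip : i < p)
    (hpk : p < k) (ha : ∀ j, i ≤ j → j < k → j ≠ p → a j ≤ -2) (hp : a p = -1)
    (hp1 : a (p - 1) ≤ -3) (hp2 : a (p + 1) ≤ -3) : 0 < x k := by
  have h1 : Growing x (p - 1) := hi.run h (by omega) fun j h1 h2 => ha j h1 (by omega) (by omega)
  obtain ⟨-, g1, g2⟩ := h1.jump h hp1 (by rwa [sub_add_cancel])
  rw [show p - 1 + 2 = p + 1 by ring] at g1 g2
  rw [show p - 1 + 3 = p + 2 by ring] at g2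
  rcases eq_or_lt_of_le (show p + 1 ≤ k by omega) with rfl | h3
  · exact g1
  · exact ((g2 hp2).run h (by omega) fun j h1 h2 => ha j (by omega) h2 (by omega)).2.2

end Growth

/-! ### Half turns -/

section HalfTurn

variable {n : ℕ} {f : ℤ → ℤ × ℤ} {a : ℤ → ℤ}

theorem CyclicFan.latticeDet_pred (h : CyclicFan n f a) (i : ℤ) :
    latticeDet (f (i - 1)) (f i) = 1 := by
  have := h.det_one (i - 1)
  rwa [sub_add_cancel] at this

theorem CyclicFan.smul_eq_zero (h : CyclicFan n f a) {i c : ℤ} (hc : c • f i = 0) : c = 0 := by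
  have := latticeDet_smul_right c (f (i - 1)) (f i)
  rw [h.latticeDet_pred, hc] at this
  simp only [latticeDet, Prod.fst_zero, Prod.snd_zero] at this
  omega

/-- Across `-2, -1, -2` the sequence makes a half turn. Geometrically, these three curves form a
fiber of a `ℙ¹`-fibration, and the two curves next to them are sections. -/
theorem CyclicFan.half_turn (h : CyclicFan n f a) {i : ℤ} (h0 : a i = -1) (h1 : a (i + 1) = -2)
    (h2 : a (i - 1) = -2) :
    f (i - 2) = -f (i + 2) ∧ f (i + 1) - f (i - 1) = f (i + 2) := by
  have e0 := h.sum_eq i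
  have e1 := h.sum_eq (i + 1)
  have e2 := h.sum_eq (i - 1)
  rw [h0] at e0
  rw [h1, add_sub_cancel_right, show i + 1 + 1 = i + 2 by ring] at e1
  rw [h2, sub_add_cancel, show i - 1 - 1 = i - 2 by ring] at e2
  constructor
  · linear_combination (exp := 1) (2 : ℤ) • e0 + e1 + e2
  · linear_combination (exp := 1) - e0 - e1

/-- A fan with `-2, -1, -2` at the places `-1, 0, 1`, at most three free curves and nothing to
contract. The sections have the places `2` and `n - 2`; the places between them are the second
fiber. -/
structure FiberedFan (n : ℕ) (f : ℤ → ℤ × ℤ) (a : ℤ → ℤ) : Prop extends CyclicFan n f a where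
  selfInt_zero : a 0 = -1
  selfInt_one : a 1 = -2
  selfInt_neg_one : a (-1) = -2
  free : AtMostThreeFree n a
  notContractible : NotContractible a

namespace FiberedFan

theorem opposite (h : FiberedFan n f a) : f (n - 2) = -f 2 := by
  have := (h.half_turn (i := 0) h.selfInt_zero h.selfInt_one h.selfInt_neg_one).1
  have e := h.periodic (-2)
  rw [show (-2 : ℤ) + n = n - 2 by ring] at e
  rw [e]
  exact this

theorem six_le (h : FiberedFan n f a) : 6 ≤ n := by
  by_contra hn
  have hpos := h.pos
  have e := h.opposite
  have d0 := h.det_one 0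
  have d1 := h.det_one 1
  have d2 := h.det_one 2
  have e3 := latticeDet_swap (f 0) (f 1)
  norm_num at d0 d1 d2
  interval_cases n
  · have := h.periodic 0
    norm_num at this
    rw [this] at d0
    simp at d0
  · have := h.periodic 0
    norm_num at this
    rw [this] at d1
    omega
  · norm_num at e
    rw [e] at d1
    simp at d1
  · norm_num at e
    have : latticeDet (f 1) (f 2) = -latticeDet (f 1) (f 2) := by
      rw [← latticeDet_neg_right, ← e]
    omega
  · norm_num at e
    rw [e] at d2
    simp at d2

theorem height_three (h : FiberedFan n f a) : latticeDet (f 2) (f 3) = 1 := h.det_one 2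

theorem height_last (h : FiberedFan n f a) : latticeDet (f 2) (f (n - 2)) = 0 := by
  rw [h.opposite]; simp

theorem height_penultimate (h : FiberedFan n f a) : latticeDet (f 2) (f (n - 3)) = 1 := by
  have := h.det_one (n - 3)
  rw [show (n : ℤ) - 3 + 1 = n - 2 by ring, h.opposite, latticeDet_neg_right,
    ← latticeDet_swap] at this
  exact this

theorem height_pos (h : FiberedFan n f a) {j : ℤ} (h1 : 2 < j) (h2 : j < n - 2) :
    0 < latticeDet (f 2) (f j) :=
  (h.between 2 j (n - 2) h1 h2 (by omega) (Or.inr h.opposite)).1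

theorem height_nonneg (h : FiberedFan n f a) {j : ℤ} (h1 : 2 ≤ j) (h2 : j ≤ n - 2) :
    0 ≤ latticeDet (f 2) (f j) := by
  rcases eq_or_lt_of_le h1 with rfl | h1
  · simp
  rcases eq_or_lt_of_le h2 with rfl | h2
  · exact h.height_last.ge
  · exact (h.height_pos h1 h2).le

/-- Only the two sections have opposite rays in the half-plane of the second fiber. -/
theorem eq_of_height_add_le_zero (h : FiberedFan n f a) {j k : ℤ} (h1 : 2 ≤ j) (hjk : j < k)
    (h2 : k ≤ n - 2) (hs : latticeDet (f 2) (f j) + latticeDet (f 2) (f k) ≤ 0) :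
    j = 2 ∧ k = n - 2 := by
  have := h.height_nonneg h1 (by omega)
  have := h.height_nonneg (j := k) (by omega) h2
  constructor
  · by_contra hc
    have := h.height_pos (j := j) (by omega) (by omega)
    omega
  · by_contra hc
    have := h.height_pos (j := k) (by omega) (by omega)
    omega

theorem growing_three (h : FiberedFan n f a) : Growing (fun i => latticeDet (f 2) (f i)) 3 := by
  have := h.height_three
  simp only [Growing]
  norm_num
  omega

theorem growing_four (h : FiberedFan n f a) (h3 : a 3 = -1) :
    Growing (fun i => latticeDet (f 2) (f i)) 4 := by
  have e := (h.isHeight (f 2)).succ 3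
  have := h.height_three
  simp only [Growing]
  norm_num [h3] at e ⊢
  omega

/-- The two sections have self-intersection numbers with sum `-1 - c`, where the ends of the second
fiber differ by `c` times the section. -/
theorem section_sum (h : FiberedFan n f a) {c : ℤ} (hc : f 3 - f (n - 3) = c • f 2) :
    a 2 + a (n - 2) = -1 - c := by
  have e2 := h.sum_eq 2
  have e3 := h.sum_eq (n - 2)
  have e4 := (h.half_turn (i := 0) h.selfInt_zero h.selfInt_one h.selfInt_neg_one).2
  have e5 := h.periodic (-1)
  rw [h.opposite, show (n : ℤ) - 2 - 1 = n - 3 by ring,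
    show (n : ℤ) - 2 + 1 = -1 + n by ring, e5] at e3
  norm_num at e2 e4
  have : (-a 2 - a (n - 2) - 1 - c) • f 2 = 0 := by
    linear_combination (exp := 1) hc - e2 + e3 + e4
  have := h.smul_eq_zero this
  omega

theorem le_neg_two_of_two (h : FiberedFan n f a) {p q j : ℤ} (hp : 0 < p) (hpq : p < q) (hq : q < n)
    (ap : -1 ≤ a p) (aq : -1 ≤ a q) (hj : 0 < j) (hjn : j < n) (hjp : j ≠ p) (hjq : j ≠ q) :
    a j ≤ -2 := by
  by_contra hc
  have h0 := h.selfInt_zero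
  rcases lt_trichotomy j p with h1 | h1 | h1
  · exact h.free 0 j p q hj h1 hpq (by omega) (by omega) (by omega) ap aq
  · exact hjp h1
  rcases lt_trichotomy j q with h2 | h2 | h2
  · exact h.free 0 p j q hp h1 h2 (by omega) (by omega) ap (by omega) aq
  · exact hjq h2
  · exact h.free 0 p q j hp hpq h2 (by omega) (by omega) ap aq (by omega)

/-- A `(-1)`-curve inside the second fiber whose neighbors are at most `-2` is the middle of the
fiber, or both neighbors are at most `-3`. -/
theorem inner_neg_one (h : FiberedFan n f a) {p : ℤ} (h1 : 3 < p) (h2 : p < n - 3) (hp : a p = -1)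
    (hm : a (p - 1) ≤ -2) (hM : a (p + 1) ≤ -2) :
    (p = 4 ∧ n = 8 ∧ a (p - 1) = -2 ∧ a (p + 1) = -2) ∨ (a (p - 1) ≤ -3 ∧ a (p + 1) ≤ -3) := by
  have hc := h.notContractible p hp
  by_cases hm2 : a (p - 1) = -2
  · have hM2 : a (p + 1) = -2 := le_antisymm hM (hc.1 hm2)
    have e := (h.half_turn hp hM2 hm2).1
    obtain ⟨e1, e2⟩ := h.eq_of_height_add_le_zero (j := p - 2) (k := p + 2) (by omega) (by omega)
      (by omega) (by rw [e, latticeDet_neg_right]; omega)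
    left
    omega
  · right
    have : a (p + 1) ≠ -2 := fun hh => hm2 (le_antisymm hm (hc.2 hh))
    omega

theorem isCycle_stdOne (h : FiberedFan n f a) {p : ℤ} (h1 : 3 ≤ p) (h2 : p ≤ n - 3)
    (hp : 0 ≤ a p) : ∃ l, IsStandardCycle l ∧ IsCycleOf n a l := by
  have e := h.isHeight (f 2) p
  have hpos := h.height_pos (j := p) (by omega) (by omega)
  have hprod : 0 ≤ a p * latticeDet (f 2) (f p) := mul_nonneg hp hpos.le
  simp only at e
  obtain ⟨e1, e2⟩ := h.eq_of_height_add_le_zero (j := p - 1) (k := p + 1) (by omega) (by omega)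
      (by omega) (by linarith)
  obtain rfl : p = 3 := by omega
  obtain rfl : n = 6 := by omega
  have h3 := h.height_three
  have hl := h.height_last
  norm_num [h3] at e hl
  rw [hl] at e
  have hs := h.section_sum (c := 0) (by norm_num)
  norm_num at hs
  have h0 := h.selfInt_zero
  have h1 := h.selfInt_one
  have hm := h.selfInt_neg_one
  have h5 := h.periodic_selfInt (-1)
  rw [h.selfInt_neg_one] at h5
  have h6 := h.periodic_selfInt 0
  have h7 := h.periodic_selfInt 1
  norm_num at h5 h6 h7
  by_cases h22 : a 2 ≤ -2
  · refine ⟨_, Or.inl ⟨-a 2, by omega, rfl⟩, rfl, 2, 1, Or.inl rfl, ?_⟩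
    intro i
    fin_cases i <;> norm_num <;> omega
  · have h42 : a 4 ≤ -2 := by
      by_contra hc
      exact h.free 0 2 3 4 (by norm_num) (by norm_num) (by norm_num) (by norm_num) (by omega)
        (by omega) (by omega) (by omega)
    refine ⟨_, Or.inl ⟨-a 4, by omega, rfl⟩, rfl, 4, -1, Or.inr rfl, ?_⟩
    intro i
    fin_cases i <;> norm_num <;> omega

theorem isCycle_stdTwo (h : FiberedFan 8 f a) (h4 : a 4 = -1) (h3 : a 3 = -2) (h5 : a 5 = -2) :
    ∃ l, IsStandardCycle l ∧ IsCycleOf 8 a l := by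
  have hh := (h.half_turn (i := 4) h4 h5 h3)
  norm_num at hh
  have hs := h.section_sum (c := 1) (by
    norm_num
    rw [hh.1, ← hh.2]
    abel)
  norm_num at hs
  have e0 := h.selfInt_zero
  have e1 := h.selfInt_one
  have e7 := h.periodic_selfInt (-1)
  rw [h.selfInt_neg_one] at e7
  norm_num at e7
  have e8 := h.periodic_selfInt 0
  have e9 := h.periodic_selfInt 1
  have e10 := h.periodic_selfInt 2
  have e11 := h.periodic_selfInt 3
  have e12 := h.periodic_selfInt 4
  have e13 := h.periodic_selfInt 5
  norm_num at e8 e9 e10 e11 e12 e13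
  by_cases h22 : a 2 ≤ -2
  · refine ⟨_, Or.inr (Or.inl ⟨-a 2, by omega, rfl⟩), rfl, 2, 1, Or.inl rfl, ?_⟩
    intro i
    fin_cases i <;> norm_num <;> omega
  · have h62 : a 6 ≤ -2 := by
      by_contra hc
      exact h.free 0 2 4 6 (by norm_num) (by norm_num) (by norm_num) (by norm_num) (by omega)
        (by omega) (by omega) (by omega)
    refine ⟨_, Or.inr (Or.inl ⟨-a 6, by omega, rfl⟩), rfl, 6, 1, Or.inl rfl, ?_⟩
    intro i
    fin_cases i <;> norm_num <;> omega

end FiberedFan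
end HalfTurn

/-! ### The second fiber -/

section SecondFiber

variable {n : ℕ} {f : ℤ → ℤ × ℤ} {a : ℤ → ℤ}

namespace FiberedFan

theorem reflect (h : FiberedFan n f a) :
    FiberedFan n (fun i : ℤ => (f (-i)).swap) (fun i : ℤ => a (-i)) where
  toCyclicFan := h.toCyclicFan.reflect
  selfInt_zero := by simpa using h.selfInt_zero
  selfInt_one := h.selfInt_neg_one
  selfInt_neg_one := by simpa using h.selfInt_one
  free := h.free.reflect
  notContractible := h.notContractible.reflect

/-- The second fiber contains a curve with self-intersection number at least `-1`. -/
theorem exists_free (h : FiberedFan n f a) : ∃ p : ℤ, 3 ≤ p ∧ p ≤ n - 3 ∧ -1 ≤ a p := by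
  by_contra! hc
  have := h.six_le
  have := (h.growing_three.run (h.isHeight _) (k := n - 2) (by omega) fun j h1 h2 => by
    have := hc j h1 (by omega)
    omega).2.2
  simp only [h.height_last] at this
  omega

/-- A `(-1)`-curve at the end of the second fiber is not the only free curve of the fiber. -/
theorem not_end_of_unique (h : FiberedFan n f a) (h3 : a 3 = -1)
    (hu : ∀ j : ℤ, 4 ≤ j → j ≤ n - 3 → a j ≤ -2) : False := by
  have := h.six_le
  have := ((h.growing_four h3).run (h.isHeight _) (k := n - 2) (by omega) fun j h1 h2 =>
    hu j h1 (by omega)).2.2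
  simp only [h.height_last] at this
  omega

/-- If a fiber has a single free curve, and this is a `(-1)`-curve, then the surface is
`S(std²ₘ)`. -/
theorem isCycle_of_unique (h : FiberedFan n f a) {p : ℤ} (h1 : 3 ≤ p) (h2 : p ≤ n - 3)
    (hp : a p = -1) (hu : ∀ j : ℤ, 3 ≤ j → j ≤ n - 3 → j ≠ p → a j ≤ -2) :
    ∃ l, IsStandardCycle l ∧ IsCycleOf n a l := by
  rcases eq_or_lt_of_le h1 with rfl | h1
  · exact (h.not_end_of_unique hp fun j hj hjn => hu j (by omega) hjn (by omega)).elim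
  rcases eq_or_lt_of_le h2 with rfl | h2
  · have e := h.periodic_selfInt (-3)
    rw [show (-3 : ℤ) + n = n - 3 by ring, hp] at e
    refine (h.reflect.not_end_of_unique e.symm fun j hj hjn => ?_).elim
    have e := h.periodic_selfInt (-j)
    rw [← e]
    exact hu _ (by omega) (by omega) (by omega)
  rcases h.inner_neg_one h1 h2 hp (hu _ (by omega) (by omega) (by omega))
    (hu _ (by omega) (by omega) (by omega)) with ⟨rfl, rfl, e1, e2⟩ | ⟨e1, e2⟩
  · exact h.isCycle_stdTwo hp e1 e2
  · have := h.growing_three.pos_through (h.isHeight _) (k := n - 2) h1 (by omega)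
      (fun j h1 h2 h3 => hu j h1 (by omega) h3) hp e1 e2
    simp only [h.height_last] at this
    omega

/-- Two adjacent `(-1)`-curves make up a whole fiber, and then one of the sections would be
free. -/
theorem not_adjacent (h : FiberedFan n f a) {p : ℤ} (h1 : 3 ≤ p) (h2 : p + 1 ≤ n - 3)
    (hp : a p = -1) (hq : a (p + 1) = -1) (hs : a 2 ≤ -2) (hs' : a (n - 2) ≤ -2) : False := by
  have e1 := h.sum_eq p
  have e2 := h.sum_eq (p + 1)
  rw [hp] at e1
  rw [hq, add_sub_cancel_right, show p + 1 + 1 = p + 2 by ring] at e2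
  have e3 : f (p - 1) = -f (p + 2) := by linear_combination (exp := 1) e1 + e2
  obtain ⟨h4, h5⟩ := h.eq_of_height_add_le_zero (j := p - 1) (k := p + 2) (by omega) (by omega)
    (by omega) (by rw [e3, latticeDet_neg_right]; omega)
  obtain rfl : p = 3 := by omega
  obtain rfl : n = 7 := by omega
  have := h.section_sum (c := 1) (by
    norm_num at e1 e2 ⊢
    linear_combination (exp := 1) - e1)
  norm_num at this hs'
  omega

/-- If a fiber contains two `(-1)`-curves, one at an end, then the other one is at the other
end. -/
theorem not_end_inner (h : FiberedFan n f a) {q : ℤ} (h3 : a 3 = -1) (h1 : 5 ≤ q) (h2 : q ≤ n - 4)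
    (hq : a q = -1) (hu : ∀ j : ℤ, 2 ≤ j → j ≤ n - 2 → j ≠ 3 → j ≠ q → a j ≤ -2) : False := by
  rcases h.inner_neg_one (by omega) (by omega) hq (hu _ (by omega) (by omega) (by omega) (by omega))
    (hu _ (by omega) (by omega) (by omega) (by omega)) with e | ⟨e1, e2⟩
  · omega
  have := (h.growing_four h3).pos_through (h.isHeight _) (p := q) (k := n - 2) (by omega) (by omega)
    (fun j h1 h2 h3 => hu j (by omega) (by omega) (by omega) h3) hq e1 e2
  simp only [h.height_last] at this
  omega

/-- If a fiber contains two `(-1)`-curves, then they are not both away from the ends. -/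
theorem not_inner_inner (h : FiberedFan n f a) {p q : ℤ} (h1 : 4 ≤ p) (hpq : p + 2 ≤ q)
    (h2 : q ≤ n - 4) (hp : a p = -1) (hq : a q = -1)
    (hu : ∀ j : ℤ, 2 ≤ j → j ≤ n - 2 → j ≠ p → j ≠ q → a j ≤ -2) : False := by
  have hx := h.isHeight (f 2)
  have hlast := h.height_last
  rcases h.inner_neg_one (by omega) (by omega) hp (hu _ (by omega) (by omega) (by omega) (by omega))
    (hu _ (by omega) (by omega) (by omega) (by omega)) with e | ⟨p1, p2⟩
  · omega
  rcases h.inner_neg_one (by omega) (by omega) hq (hu _ (by omega) (by omega) (by omega) (by omega))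
    (hu _ (by omega) (by omega) (by omega) (by omega)) with e | ⟨q1, q2⟩
  · omega
  have g1 : Growing (fun i => latticeDet (f 2) (f i)) (p - 1) :=
    h.growing_three.run hx (by omega) fun j _ _ =>
      hu j (by omega) (by omega) (by omega) (by omega)
  rcases eq_or_lt_of_le hpq with rfl | hlt
  · rw [show p + 2 - 1 = p + 1 by ring] at q1
    rw [show p + 2 + 1 = p + 3 by ring] at q2
    by_cases ht : a (p + 1) ≤ -4
    · have g2 := g1.double_jump hx p1 (by rwa [sub_add_cancel])
        (by rwa [show p - 1 + 2 = p + 1 by ring]) (by rwa [show p - 1 + 3 = p + 2 by ring])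
        (by rwa [show p - 1 + 4 = p + 3 by ring])
      have := (g2.run hx (k := n - 2) (by omega) fun j _ _ =>
        hu j (by omega) (by omega) (by omega) (by omega)).2.2
      simp only [hlast] at this
      omega
    · -- Now the two `(-1)`-curves have a common neighbor, which is the sum of `f (p - 1)` and
      -- `f (p + 3)`. These two form a basis, but they lie on different sides of the line of `f 1`.
      have ht : a (p + 1) = -3 := by omega
      have e1 := h.sum_eq p
      have e2 := h.sum_eq (p + 1)
      have e3 := h.sum_eq (p + 2)
      rw [hp] at e1
      rw [ht, add_sub_cancel_right, show p + 1 + 1 = p + 2 by ring] at e2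
      rw [hq, show p + 2 - 1 = p + 1 by ring, show p + 2 + 1 = p + 3 by ring] at e3
      have e4 : f (p + 3) = f p - (2 : ℤ) • f (p - 1) := by
        linear_combination (exp := 1) e3 + e2 + (2 : ℤ) • e1
      have hdet : latticeDet (f (p - 1)) (f (p + 3)) = 1 := by
        rw [e4, sub_eq_add_neg (f p), latticeDet_add_right, latticeDet_neg_right,
          latticeDet_smul_right, latticeDet_self, h.latticeDet_pred]
        ring
      have hg := h.isHeight (f 1)
      have h12 : latticeDet (f 1) (f 2) = 1 := h.det_one 1
      have k1 : 0 < latticeDet (f 1) (f (p - 1)) := by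
        have : Growing (fun i => latticeDet (f 1) (f i)) 2 := by
          simp only [Growing]
          norm_num [h12]
        exact (this.run hg (by omega) fun j _ _ =>
          hu j (by omega) (by omega) (by omega) (by omega)).2.2
      have k2 : 0 < -latticeDet (f 1) (f (p + 3)) := by
        have hg' := hg.neg.reflect
        have e5 := (h.half_turn (i := 0) h.selfInt_zero h.selfInt_one h.selfInt_neg_one).2
        have e6 := h.periodic (-1)
        rw [show (-1 : ℤ) + n = n - 1 by ring] at e6
        norm_num at e5
        have h13 : latticeDet (f 1) (f (n - 1)) = -1 := by
          have : f (n - 1) = f 1 + -f 2 := by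
            rw [e6]; linear_combination (exp := 1) - e5
          rw [this, latticeDet_add_right, latticeDet_neg_right, h12, latticeDet_self]
          norm_num
        have : Growing (fun i => -latticeDet (f 1) (f (-i))) (-(n - 2)) := by
          simp only [Growing]
          rw [show -(-((n : ℤ) - 2) - 1) = n - 1 by ring, neg_neg, h13, h.opposite,
            latticeDet_neg_right, h12]
          norm_num
        have := (this.run hg' (k := -(p + 3)) (by omega) fun j _ _ =>
          hu (-j) (by omega) (by omega) (by omega) (by omega)).2.2
        simpa only [neg_neg] using this
      have k3 := h.height_pos (j := p - 1) (by omega) (by omega)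
      have k4 := h.height_pos (j := p + 3) (by omega) (by omega)
      have hP := latticeDet_plucker (f 1) (f (p - 1)) (f 2) (f (p + 3))
      rw [h12, hdet, latticeDet_swap (f 2) (f (p - 1))] at hP
      nlinarith
  · obtain ⟨-, -, g2⟩ := g1.jump hx p1 (by rwa [sub_add_cancel])
    rw [show p - 1 + 2 = p + 1 by ring, show p - 1 + 3 = p + 2 by ring] at g2
    have := (g2 p2).pos_through hx (p := q) (k := n - 2) (by omega) (by omega)
      (fun j h1 h2 h3 => hu j (by omega) (by omega) (by omega) h3) hq q1 q2
    simp only [hlast] at this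
    omega

/-- If a fiber has a `(-1)`-curve at each end and no further free curve, then the surface is
`S(3A₂)`. -/
theorem isCycle_of_ends (h : FiberedFan n f a) (hn : 8 ≤ n) (h3 : a 3 = -1) (hq : a (n - 3) = -1)
    (hu : ∀ j : ℤ, 2 ≤ j → j ≤ n - 2 → j ≠ 3 → j ≠ n - 3 → a j ≤ -2) :
    ∃ l, IsStandardCycle l ∧ IsCycleOf n a l := by
  have hx := h.isHeight (f 2)
  have hgrow : ∀ j : ℤ, 4 ≤ j → j ≤ n - 3 → Growing (fun i => latticeDet (f 2) (f i)) j :=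
    fun j h1 h2 => (h.growing_four h3).run hx h1 fun j _ _ =>
      hu j (by omega) (by omega) (by omega) (by omega)
  -- The heights in the second fiber do not decrease and are `1` at both ends, hence they are `1`.
  have hle : ∀ j : ℤ, 4 ≤ j → j ≤ n - 3 → latticeDet (f 2) (f 3) ≤ latticeDet (f 2) (f j) := by
    intro j h1
    induction j, h1 using Int.leInduction with
    | base => exact fun _ => (hgrow 4 (by omega) (by omega)).2.1
    | succ k hk ih =>
      intro h2
      have := (hgrow (k + 1) (by omega) h2).2.1
      rw [add_sub_cancel_right] at this
      exact (ih (by omega)).trans this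
  have hge : ∀ k : ℕ, 3 ≤ (n : ℤ) - 3 - k → latticeDet (f 2) (f (n - 3 - k)) ≤ 1 := by
    intro k
    induction k with
    | zero => intro _; simpa using h.height_penultimate.le
    | succ k ih =>
      intro h2
      push_cast at h2 ⊢
      have := (hgrow (n - 3 - k) (by omega) (by omega)).2.1
      rw [show (n : ℤ) - 3 - k - 1 = n - 3 - (k + 1) by ring] at this
      exact this.trans (ih (by omega))
  have hone : ∀ j : ℤ, 3 ≤ j → j ≤ n - 3 → latticeDet (f 2) (f j) = 1 := by
    intro j h1 h2
    refine le_antisymm ?_ ?_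
    · have := hge (n - 3 - j).toNat (by omega)
      rwa [show (n : ℤ) - 3 - (n - 3 - j).toNat = j by omega] at this
    · rcases eq_or_lt_of_le h1 with rfl | h1
      · exact h.height_three.ge
      · exact h.height_three ▸ hle j h1 h2
  have htwo : ∀ j : ℤ, 4 ≤ j → j ≤ n - 4 → a j = -2 := by
    intro j h1 h2
    have := hx j
    simp only at this
    rw [hone _ (by omega) (by omega), hone _ (by omega) (by omega),
      hone _ (by omega) (by omega)] at this
    omega
  have hs : a 2 = -2 := le_antisymm (hu 2 (by omega) (by omega) (by omega) (by omega))
    ((h.notContractible 3 h3).2 (htwo 4 (by omega) (by omega)))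
  have hs' : a (n - 2) = -2 := by
    refine le_antisymm (hu _ (by omega) (by omega) (by omega) (by omega)) ?_
    have := (h.notContractible (n - 3) hq).1
    rw [show (n : ℤ) - 3 - 1 = n - 4 by ring, show (n : ℤ) - 3 + 1 = n - 2 by ring] at this
    exact this (htwo _ (by omega) (by omega))
  -- The rays of the second fiber form an arithmetic progression.
  have harith : ∀ j : ℤ, 3 ≤ j → j ≤ n - 4 →
      f j = f 3 - (j - 3) • f 2 ∧ f (j + 1) = f 3 - (j - 2) • f 2 := by
    intro j h1
    induction j, h1 using Int.leInduction with
    | base =>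
      intro _
      have := h.sum_eq 3
      rw [h3] at this
      norm_num at this ⊢
      linear_combination (exp := 1) this
    | succ k hk ih =>
      intro h2
      obtain ⟨i1, i2⟩ := ih (by omega)
      have := h.sum_eq (k + 1)
      rw [htwo (k + 1) (by omega) (by omega), add_sub_cancel_right, i1, i2] at this
      refine ⟨by rw [i2]; congr 2; ring, ?_⟩
      linear_combination (exp := 1) this
  have hend := (harith (n - 4) (by omega) le_rfl).2
  rw [show (n : ℤ) - 4 + 1 = n - 3 by ring] at hend
  have hsum := h.section_sum (c := n - 6) (by rw [hend]; module)
  obtain rfl : n = 9 := by omega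
  have e0 := h.selfInt_zero
  have e1 := h.selfInt_one
  have em := h.selfInt_neg_one
  have e2 := h.periodic_selfInt (-2)
  have e4 := htwo 4 (by norm_num) (by norm_num)
  have e5 := htwo 5 (by norm_num) (by norm_num)
  norm_num at hs' hq e2
  refine ⟨_, Or.inr (Or.inr rfl), rfl, -2, 1, Or.inl rfl, ?_⟩
  intro i
  fin_cases i <;> norm_num <;> omega

theorem isCycle (h : FiberedFan n f a) : ∃ l, IsStandardCycle l ∧ IsCycleOf n a l := by
  by_cases h0 : ∃ p : ℤ, 3 ≤ p ∧ p ≤ n - 3 ∧ 0 ≤ a p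
  · obtain ⟨p, h1, h2, hp⟩ := h0
    exact h.isCycle_stdOne h1 h2 hp
  push Not at h0
  obtain ⟨p₀, hp₀, hp₀', ap₀⟩ := h.exists_free
  by_cases hu : ∀ j : ℤ, 3 ≤ j → j ≤ n - 3 → j ≠ p₀ → a j ≤ -2
  · exact h.isCycle_of_unique hp₀ hp₀' (by have := h0 p₀ hp₀ hp₀'; omega) hu
  push Not at hu
  obtain ⟨q₀, hq₀, hq₀', hne, aq₀⟩ := hu
  obtain ⟨p, q, hp, hpq, hq, ap, aq⟩ :
      ∃ p q : ℤ, 3 ≤ p ∧ p < q ∧ q ≤ n - 3 ∧ a p = -1 ∧ a q = -1 := by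
    have := h0 p₀ hp₀ hp₀'
    have := h0 q₀ hq₀ hq₀'
    rcases lt_or_gt_of_ne hne with hlt | hlt
    · exact ⟨q₀, p₀, hq₀, hlt, hp₀', by omega, by omega⟩
    · exact ⟨p₀, q₀, hp₀, hlt, hq₀', by omega, by omega⟩
  have hu : ∀ j : ℤ, 2 ≤ j → j ≤ n - 2 → j ≠ p → j ≠ q → a j ≤ -2 := fun j h1 h2 =>
    h.le_neg_two_of_two (by omega) hpq (by omega) ap.ge aq.ge (by omega) (by omega)
  rcases eq_or_lt_of_le (show p + 1 ≤ q by omega) with rfl | hpq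
  · exact (h.not_adjacent hp hq ap aq (hu _ (by omega) (by omega) (by omega) (by omega))
      (hu _ (by omega) (by omega) (by omega) (by omega))).elim
  rcases eq_or_lt_of_le hp with rfl | hp <;> rcases eq_or_lt_of_le hq with rfl | hq
  · exact h.isCycle_of_ends (by omega) ap aq hu
  · exact (h.not_end_inner ap (by omega) (by omega) aq hu).elim
  · have e := h.periodic_selfInt (-3)
    rw [show (-3 : ℤ) + n = n - 3 by ring, aq] at e
    have e' := h.periodic_selfInt (p - n)
    rw [sub_add_cancel, ap] at e'
    refine (h.reflect.not_end_inner (q := n - p) e.symm (by omega) (by omega)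
      (by rw [neg_sub]; exact e'.symm) fun j h1 h2 h3 h4 => ?_).elim
    rw [← h.periodic_selfInt (-j)]
    exact hu _ (by omega) (by omega) (by omega) (by omega)
  · exact (h.not_inner_inner (by omega) (by omega) (by omega) ap aq hu).elim

end FiberedFan
end SecondFiber

/-! ### Classification of the surfaces without a contraction -/

section Classification

variable {n : ℕ} {f : ℤ → ℤ × ℤ} {a : ℤ → ℤ}

namespace CyclicFan

theorem three_le (h : CyclicFan n f a) : 3 ≤ n := by
  by_contra hn
  have hpos := h.pos
  have d0 := h.det_one 0
  have d1 := h.det_one 1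
  have e3 := latticeDet_swap (f 0) (f 1)
  have := h.periodic 0
  norm_num at d0 d1 this
  interval_cases n
  · norm_num at this
    rw [this] at d0
    simp at d0
  · norm_num at this
    rw [this] at d1
    omega

theorem periodic_sub (h : CyclicFan n f a) (i : ℤ) : f (n - i) = f (-i) := by
  rw [← h.periodic (-i)]
  congr 1
  ring

theorem periodic_selfInt_sub (h : CyclicFan n f a) (i : ℤ) : a (n - i) = a (-i) := by
  rw [← h.periodic_selfInt (-i)]
  congr 1
  ring

theorem growing_succ (h : CyclicFan n f a) (i : ℤ) :
    Growing (fun j => latticeDet (f i) (f j)) (i + 1) := by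
  simp [Growing, h.det_one i]

theorem growing_pred (h : CyclicFan n f a) (i : ℤ) :
    Growing (fun j : ℤ => -latticeDet (f i) (f (-j))) (-(i - 1)) := by
  have h1 := h.latticeDet_pred i
  have h2 := latticeDet_swap (f (i - 1)) (f i)
  simp only [Growing, neg_sub, show -(1 - i - 1) = i by ring, show -(1 - i) = i - 1 by ring,
    latticeDet_self]
  omega

/-- If no fiber is of the form `-2, -1, -2`, then a `(-1)`-curve cannot have a neighbor `≤ -2` on
one side and a free curve on the other side. -/
theorem not_free_neighbor (h : CyclicFan n f a) (hfree : AtMostThreeFree n a)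
    (hno : ∀ i, a i = -1 → a (i - 1) ≤ -2 → a (i + 1) ≤ -2 → a (i - 1) ≤ -3 ∧ a (i + 1) ≤ -3)
    (h0 : a 0 = -1) (h1 : a 1 ≤ -2) (hm : -1 ≤ a (-1)) : False := by
  have hn := h.three_le
  have s0 := h.sum_eq 0
  have fn1 := h.periodic_sub 1
  have an1 := h.periodic_selfInt_sub 1
  have fn0 := h.periodic_sub 0
  rw [h0] at s0
  norm_num at s0 fn0
  have sn := h.sum_eq (n - 1)
  rw [sub_add_cancel, fn0, an1, fn1, show (n : ℤ) - 1 - 1 = n - 2 by ring] at sn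
  -- Heights over `f (-1)`: they grow, unless a third free curve stops them.
  have hg := h.isHeight (f (-1))
  have g0 : latticeDet (f (-1)) (f 0) = 1 := h.det_one (-1)
  have g1 : Growing (fun j => latticeDet (f (-1)) (f j)) 1 := by
    have e := (h.growing_succ (-1)).2.2
    have := hg.succ 0
    simp only [Growing]
    norm_num [h0, g0] at this ⊢
    omega
  have glast : latticeDet (f (-1)) (f (n - 2)) = -1 := by
    have := h.latticeDet_pred (n - 1)
    rw [fn1, show (n : ℤ) - 1 - 1 = n - 2 by ring] at this
    rw [latticeDet_swap, this]
  by_cases hF : ∀ j : ℤ, 1 ≤ j → j < n - 2 → a j ≤ -2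
  · have := (g1.run hg (k := n - 2) (by omega) hF).2.2
    simp only [glast] at this
    omega
  push Not at hF
  obtain ⟨p, hp1, hpn, hp⟩ := hF
  have hp2 : 2 ≤ p := by
    by_contra hc
    obtain rfl : p = 1 := by omega
    omega
  have hu : ∀ j : ℤ, 1 ≤ j → j ≤ n - 2 → j ≠ p → a j ≤ -2 := by
    intro j hj1 hj2 hjp
    by_contra hc
    rcases lt_or_gt_of_ne hjp with hlt | hlt
    · exact hfree (-1) 0 j p (by omega) (by omega) hlt (by omega) hm (by omega) (by omega)
        (by omega)
    · exact hfree (-1) 0 p j (by omega) (by omega) hlt (by omega) hm (by omega) (by omega)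
        (by omega)
  by_cases hp0 : a p = -1
  · obtain ⟨e1, e2⟩ := hno p hp0 (hu _ (by omega) (by omega) (by omega))
      (hu _ (by omega) (by omega) (by omega))
    have := g1.pos_through hg (p := p) (k := n - 2) (by omega) hpn
      (fun j h1 h2 h3 => hu j h1 (by omega) h3) hp0 e1 e2
    simp only [glast] at this
    omega
  -- At a nonnegative curve the heights over `f 0` become negative.
  have hy := h.isHeight (f 0)
  have y1 : Growing (fun j => latticeDet (f 0) (f j)) 1 := h.growing_succ 0
  have yp := y1.run hy (k := p) hp1 fun j h1 h2 => hu j h1 (by omega) (by omega)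
  have yp' := y1.run hy (k := p - 1) (by omega) fun j h1 h2 => hu j h1 (by omega) (by omega)
  have ys := hy.succ p
  have ylast : latticeDet (f 0) (f (n - 2)) = a (-1) := by
    have e : f (n - 2) = (-a (-1)) • f (-1) + -f 0 := by rw [← sn]; abel
    rw [e, latticeDet_add_right, latticeDet_smul_right, latticeDet_neg_right, latticeDet_self,
      latticeDet_swap (f (-1)), g0]
    ring
  have yneg : latticeDet (f 0) (f (p + 1)) < 0 := by
    have := mul_nonneg (show 0 ≤ a p by omega) yp.2.2.le
    have := yp'.2.2
    simp only at *
    linarith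
  -- If `a (-1) ≥ 0`, the angle from `f 0` to `f (n - 2)` is at most `π`.
  have hm1 : a (-1) = -1 := by
    by_contra hc
    rcases eq_or_lt_of_le (show p + 1 ≤ n - 2 by omega) with he | hlt
    · rw [he] at yneg
      omega
    · have := (h.between 0 (p + 1) (n - 2) (by omega) hlt (by omega) (by
        rcases eq_or_ne (a (-1)) 0 with hz | hz
        · right
          rw [hz] at sn
          norm_num at sn
          exact eq_neg_of_add_eq_zero_left sn
        · left
          omega)).1
      omega
  rw [hm1] at sn
  -- If `a (-1) = -1`, the rays from `f 1` to `f (n - 2)` fill a half-plane, and so `f p` is the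
  -- only ray strictly between these two. Then `n = 5` and `a 1 + a 3 = -1`.
  have hop : f (n - 2) = -f 1 := by linear_combination (exp := 1) sn + s0
  have hz := h.isHeight (f 1)
  have z2 : Growing (fun j => latticeDet (f 1) (f j)) 2 := h.growing_succ 1
  have zp := z2.run hz (k := p) hp2 fun j h1 h2 => hu j (by omega) (by omega) (by omega)
  have zs := hz.succ p
  have zprod := mul_nonneg (show 0 ≤ a p by omega) zp.2.2.le
  have zp0 := zp.1
  simp only at zs zprod zp0
  have hpe : p + 1 = n - 2 := by
    by_contra hc
    have := (h.between 1 (p + 1) (n - 2) (by omega) (by omega) (by omega) (Or.inr hop)).1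
    linarith
  have hp2' : p = 2 := by
    by_contra hc
    have := (z2.run hz (k := p - 1) (by omega) fun j h1 h2 =>
      hu j (by omega) (by omega) (by omega)).2.2
    rw [hpe, hop, latticeDet_neg_right, latticeDet_self] at zs
    simp only at this
    linarith
  subst hp2'
  obtain rfl : n = 5 := by omega
  have t1 := h.sum_eq 1
  have t3 := h.sum_eq 3
  norm_num at hop t1 t3 fn1 sn
  rw [hop, fn1] at t3
  have hzero : (-a 1 - 1 - a 3) • f 1 = 0 := by
    linear_combination (exp := 1) t3 - t1 - s0
  have := h.smul_eq_zero hzero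
  have := hu 3 (by norm_num) (by norm_num) (by norm_num)
  omega

/-- Of two adjacent curves that are free, apart from a single `(-1)`-curve with neighbors `≤ -3`
elsewhere, the first one has positive self-intersection number. -/
theorem selfInt_pos_of_adjacent (h : CyclicFan n f a) {p : ℤ} (hp : 2 ≤ p) (hpn : p + 1 ≤ n - 2)
    (h0 : a 0 = -1) (h1 : a 1 ≤ -3) (hm : a (-1) ≤ -3)
    (hu : ∀ j : ℤ, 1 ≤ j → j ≤ n - 1 → j ≠ p → j ≠ p + 1 → a j ≤ -2) : 0 < a p := by
  have hx := h.isHeight (f (p + 1))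
  have p0 := h.periodic_selfInt 0
  have p1 := h.periodic_selfInt 1
  have pm := h.periodic_selfInt (-1)
  rw [zero_add] at p0
  rw [add_comm] at p1
  rw [neg_add_eq_sub] at pm
  have := (h.growing_succ (p + 1)).pos_through hx (p := n) (k := p - 1 + n) (by omega) (by omega)
    (fun j j1 j2 j3 => by
      rcases lt_or_gt_of_ne j3 with hlt | hlt
      · exact hu j (by omega) (by omega) (by omega) (by omega)
      · have := h.periodic_selfInt (j - n)
        rw [sub_add_cancel] at this
        rw [this]
        exact hu _ (by omega) (by omega) (by omega) (by omega))
    (p0.trans h0) (pm.le.trans hm) (p1.le.trans h1)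
  simp only [h.periodic] at this
  have e : f (p - 1) = (-a p) • f p + -f (p + 1) := by rw [← h.sum_eq]; abel
  rw [e, latticeDet_add_right, latticeDet_smul_right, latticeDet_neg_right, latticeDet_self,
    latticeDet_swap (f p), h.det_one] at this
  linarith

/-- It is impossible that every `(-1)`-curve with some neighbor `≤ -2` has both neighbors `≤ -3`,
if there is such a curve. -/
theorem not_neighbors_le (h : CyclicFan n f a) (hfree : AtMostThreeFree n a)
    (hno : ∀ i, a i = -1 → a (i - 1) ≤ -2 ∨ a (i + 1) ≤ -2 → a (i - 1) ≤ -3 ∧ a (i + 1) ≤ -3)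
    (h0 : a 0 = -1) (h1 : a 1 ≤ -3) (hm : a (-1) ≤ -3) : False := by
  have hn := h.three_le
  have hy := h.isHeight (f 0)
  have y1 : Growing (fun j => latticeDet (f 0) (f j)) 1 := h.growing_succ 0
  have hy' := hy.neg.reflect
  have yn : Growing (fun j : ℤ => -latticeDet (f 0) (f (-j))) (-(n - 1)) := by
    have := h.growing_pred n
    have e := h.periodic 0
    rw [zero_add] at e
    rwa [e] at this
  have an1 := h.periodic_selfInt_sub 1
  -- `p` and `q` are the first and the last free curve apart from `f 0`.
  obtain ⟨p, q, hp, hpq, hq, ap, aq, hu⟩ : ∃ p q : ℤ, 2 ≤ p ∧ p ≤ q ∧ q ≤ n - 2 ∧ -1 ≤ a p ∧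
      -1 ≤ a q ∧ ∀ j : ℤ, 1 ≤ j → j ≤ n - 1 → j ≠ p → j ≠ q → a j ≤ -2 := by
    have bound : ∀ j : ℤ, 1 ≤ j → j ≤ n - 1 → -1 ≤ a j → 2 ≤ j ∧ j ≤ n - 2 := by
      intro j j1 j2 j3
      have : j ≠ 1 := by rintro rfl; omega
      have : j ≠ n - 1 := by rintro rfl; omega
      omega
    have hex : ∃ j : ℤ, 1 ≤ j ∧ j ≤ n - 1 ∧ -1 ≤ a j := by
      by_contra! hc
      have k1 := (y1.run hy (k := n - 1) (by omega) fun j j1 j2 => by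
        have := hc j j1 (by omega)
        omega).2.2
      have k2 := yn.2.2
      simp only [neg_neg] at k1 k2
      omega
    obtain ⟨r, r1, r2, r3⟩ := hex
    obtain ⟨b1, b2⟩ := bound r r1 r2 r3
    by_cases hr : ∀ j : ℤ, 1 ≤ j → j ≤ n - 1 → j ≠ r → a j ≤ -2
    · exact ⟨r, r, b1, le_rfl, b2, r3, r3, fun j j1 j2 j3 _ => hr j j1 j2 j3⟩
    push Not at hr
    obtain ⟨s, s1, s2, hne, s3⟩ := hr
    obtain ⟨c1, c2⟩ := bound s s1 s2 (by omega)
    have others : ∀ p q : ℤ, 1 ≤ p → p < q → q ≤ n - 1 → -1 ≤ a p → -1 ≤ a q →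
        ∀ j : ℤ, 1 ≤ j → j ≤ n - 1 → j ≠ p → j ≠ q → a j ≤ -2 := by
      intro p q p1 hpq q1 ap aq j j1 j2 jp jq
      by_contra hc
      have k : ∀ i j k : ℤ, 1 ≤ i → i < j → j < k → k ≤ n - 1 → -1 ≤ a i → -1 ≤ a j → -1 ≤ a k →
          False := fun i j k k1 k2 k3 k4 =>
        hfree 0 i j k (by omega) k2 k3 (by omega) (by omega)
      rcases lt_or_gt_of_ne jp with hlt | hlt
      · exact k j p q j1 hlt hpq q1 (by omega) ap aq
      rcases lt_or_gt_of_ne jq with hlt' | hlt'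
      · exact k p j q p1 hlt hlt' q1 ap (by omega) aq
      · exact k p q j p1 hpq hlt' j2 ap aq (by omega)
    rcases lt_or_gt_of_ne hne with hlt | hlt
    · exact ⟨s, r, c1, hlt.le, b2, by omega, r3, others _ _ s1 hlt r2 (by omega) r3⟩
    · exact ⟨r, s, b1, hlt.le, c2, r3, by omega, others _ _ r1 hlt s2 r3 (by omega)⟩
  have yp := y1.run hy (k := p) (by omega) fun j j1 j2 =>
    hu j j1 (by omega) (by omega) (by omega)
  have yp' := (y1.run hy (k := p - 1) (by omega) fun j j1 j2 =>
    hu j j1 (by omega) (by omega) (by omega)).2.2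
  have yq := yn.run hy' (k := -q) (by omega) fun j j1 j2 =>
    hu (-j) (by omega) (by omega) (by omega) (by omega)
  have yq' := (yn.run hy' (k := -(q + 1)) (by omega) fun j j1 j2 =>
    hu (-j) (by omega) (by omega) (by omega) (by omega)).2.2
  replace yp := yp.2.2
  replace yq := yq.2.2
  simp only [neg_neg] at yp yp' yq yq'
  have hlt : p < q := by
    rcases eq_or_lt_of_le hpq with rfl | hlt
    · omega
    · exact hlt
  have ap0 : a p ≠ -1 := by
    intro hc
    obtain ⟨e1, e2⟩ := hno p hc (Or.inl (hu _ (by omega) (by omega) (by omega) (by omega)))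
    have := y1.pos_through hy (p := p) (k := q) (by omega) hlt (fun j j1 j2 j3 =>
      hu j j1 (by omega) j3 (by omega)) hc e1 e2
    omega
  have aq0 : a q ≠ -1 := by
    intro hc
    obtain ⟨e1, e2⟩ := hno q hc (Or.inr (hu _ (by omega) (by omega) (by omega) (by omega)))
    have := yn.pos_through hy' (p := -q) (k := -p) (by omega) (by omega) (fun j j1 j2 j3 =>
      hu (-j) (by omega) (by omega) (by omega) (by omega)) (by rw [neg_neg]; exact hc)
      (by rw [show -(-q - 1) = q + 1 by ring]; exact e2)
      (by rw [show -(-q + 1) = q - 1 by ring]; exact e1)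
    simp only [neg_neg] at this
    omega
  have ys := hy p
  have ys' := hy q
  simp only at ys ys'
  have ypos := mul_nonneg (show 0 ≤ a p by omega) yp.le
  have yneg := mul_nonneg (show 0 ≤ a q by omega) yq.le
  -- The heights are positive up to `p` and negative from `q` on, but already negative at `p + 1`
  -- and still positive at `q - 1`.
  obtain rfl : q = p + 1 := by
    by_contra hc
    have k1 : latticeDet (f 0) (f (p + 1)) < 0 := by linarith
    have k2 : 0 < latticeDet (f 0) (f (q - 1)) := by linarith
    rcases eq_or_lt_of_le (show p + 1 ≤ q - 1 by omega) with he | hlt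
    · rw [he] at k1
      omega
    · have := (h.between 0 (p + 1) (q - 1) (by omega) hlt (by omega) (Or.inl k2)).1
      omega
  have bp := h.selfInt_pos_of_adjacent hp hq h0 h1 hm hu
  have bq : 0 < a (p + 1) := by
    have e := h.reflect.selfInt_pos_of_adjacent (p := n - (p + 1)) (by omega) (by omega)
      (by simpa using h0) hm (by simpa using h1) (fun j j1 j2 j3 j4 => by
        rw [← h.periodic_selfInt (-j)]
        exact hu _ (by omega) (by omega) (by omega) (by omega))
    rw [← h.periodic_selfInt] at e
    convert e using 2
    ring
  rw [add_sub_cancel_right] at ys'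
  have : latticeDet (f 0) (f p) ≤ a p * latticeDet (f 0) (f p) :=
    le_mul_of_one_le_left yp.le bp
  have : -latticeDet (f 0) (f (p + 1)) ≤ a (p + 1) * -latticeDet (f 0) (f (p + 1)) :=
    le_mul_of_one_le_left yq.le bq
  linarith

/-- A smooth complete fan with at most three free curves, with a `(-1)`-curve that meets a curve
of self-intersection at most `-2`, is one of the standard ones or admits a contraction. -/
theorem isCycle_of_notContractible (h : CyclicFan n f a) (hfree : AtMostThreeFree n a)
    (hc : NotContractible a) {i : ℤ} (hi : a i = -1) (hi' : a (i - 1) ≤ -2 ∨ a (i + 1) ≤ -2) :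
    ∃ l, IsStandardCycle l ∧ IsCycleOf n a l := by
  by_cases hI : ∃ i, a i = -1 ∧ a (i + 1) = -2 ∧ a (i - 1) = -2
  · obtain ⟨c, c0, c1, c2⟩ := hI
    have hF : FiberedFan n (fun i => f (c + i)) (fun i => a (c + i)) :=
      { h.shift c with
        selfInt_zero := by simpa using c0
        selfInt_one := c1
        selfInt_neg_one := c2
        free := hfree.shift c
        notContractible := hc.shift c }
    obtain ⟨l, h1, h2⟩ := hF.isCycle
    exact ⟨l, h1, h2.of_shift⟩
  exfalso
  have hno : ∀ i, a i = -1 → a (i - 1) ≤ -2 → a (i + 1) ≤ -2 →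
      a (i - 1) ≤ -3 ∧ a (i + 1) ≤ -3 := by
    intro i h0 h1 h2
    have h3 := hc i h0
    by_cases h4 : a (i + 1) = -2
    · exact absurd ⟨i, h0, h4, le_antisymm h1 (h3.2 h4)⟩ hI
    · have : a (i - 1) ≠ -2 := fun h5 => h4 (le_antisymm h2 (h3.1 h5))
      omega
  have hr : ∀ i, a i = -1 → a (i + 1) ≤ -2 → a (i - 1) ≤ -2 := by
    intro i h0 h1
    by_contra h2
    refine (h.shift i).not_free_neighbor (hfree.shift i) (fun j h3 h4 h5 => ?_)
      (by simpa using h0) h1 (show -1 ≤ a (i - 1) by omega)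
    rw [← add_sub_assoc] at h4 ⊢
    rw [← add_assoc] at h5 ⊢
    exact hno _ h3 h4 h5
  have hl : ∀ i, a i = -1 → a (i - 1) ≤ -2 → a (i + 1) ≤ -2 := by
    intro i h0 h1
    by_contra h2
    refine (h.shift i).reflect.not_free_neighbor (hfree.shift i).reflect (fun j h3 h4 h5 => ?_)
      (by simpa using h0) h1 (show -1 ≤ a (i + - -1) by rw [neg_neg]; omega)
    rw [show i + -(j - 1) = i + -j + 1 by ring] at h4 ⊢
    rw [show i + -(j + 1) = i + -j - 1 by ring] at h5 ⊢
    exact (hno _ h3 h5 h4).symm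
  have hno' : ∀ i, a i = -1 → a (i - 1) ≤ -2 ∨ a (i + 1) ≤ -2 →
      a (i - 1) ≤ -3 ∧ a (i + 1) ≤ -3 := by
    rintro i h0 (h1 | h1)
    · exact hno i h0 h1 (hl i h0 h1)
    · exact hno i h0 (hr i h0 h1) h1
  obtain ⟨k1, k2⟩ := hno' i hi hi'
  refine (h.shift i).not_neighbors_le (hfree.shift i) (fun j h3 h4 => ?_) (by simpa using hi) k2 k1
  rw [← add_sub_assoc, ← add_assoc] at h4 ⊢
  exact hno' _ h3 h4

end CyclicFan
end Classification

namespace CompleteToricSurface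

variable {S : CompleteToricSurface}

/-! ### The cyclic sequence of the rays of a surface -/

/-- The rays in counterclockwise order, starting at `u`. -/
noncomputable def raySeq (u : S.rays) (i : ℤ) : S.rays := (S.rotation ^ i) u

theorem raySeq_zero (u : S.rays) : raySeq u 0 = u := rfl

theorem raySeq_add (u : S.rays) (i j : ℤ) : raySeq u (i + j) = raySeq (raySeq u i) j := by
  unfold raySeq
  rw [add_comm, zpow_add, Equiv.Perm.mul_apply]

theorem next_raySeq (u : S.rays) (i : ℤ) : next (raySeq u i) = raySeq u (i + 1) := by
  rw [raySeq_add]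
  rfl

theorem isCone_raySeq (u : S.rays) (i : ℤ) : S.IsCone (raySeq u i) (raySeq u (i + 1)) := by
  rw [← next_raySeq]
  exact isCone_next _

theorem raySeq_eq_iff (u : S.rays) {i j : ℤ} :
    raySeq u i = raySeq u j ↔ i ≡ j [ZMOD S.rays.card] := by
  have := (isCycleOn_rotation (S := S)).zpow_apply_eq_zpow_apply (Finset.mem_univ u) (m := i)
    (n := j)
  rwa [Finset.card_univ, Fintype.card_coe] at this

theorem isCone_raySeq_iff (u : S.rays) {i j : ℤ} :
    S.IsCone (raySeq u i) (raySeq u j) ↔ i + 1 ≡ j [ZMOD S.rays.card] := by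
  rw [isCone_iff_next, next_raySeq, raySeq_eq_iff]

theorem exists_isCone_left (u : S.rays) : ∃ v : S.rays, S.IsCone v u :=
  ⟨S.rotation.symm u, isCone_iff_next.mpr (S.rotation.apply_symm_apply u)⟩

theorem cyclicFan (hS : S.IsSmooth) (u : S.rays) :
    CyclicFan S.rays.card (fun i => (raySeq u i : ℤ × ℤ)) (fun i => S.selfInt (raySeq u i)) where
  pos := Finset.card_pos.mpr ⟨u, u.2⟩
  det_one i := hS _ _ (isCone_raySeq u i)
  sum_eq i := by
    refine IsCone.sum_eq hS ?_ (isCone_raySeq u i)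
    have := isCone_raySeq u (i - 1)
    rwa [sub_add_cancel] at this
  periodic i := by
    have : raySeq u (i + S.rays.card) = raySeq u i := (raySeq_eq_iff u).mpr (by simp)
    rw [this]
  periodic_selfInt i := by
    have : raySeq u (i + S.rays.card) = raySeq u i := (raySeq_eq_iff u).mpr (by simp)
    rw [this]
  between i j k hij hjk hk h := by
    set v := raySeq u i with hv
    obtain ⟨m, hm0, hm, hmj⟩ : ∃ m : ℕ, 0 < m ∧ (S.rotation ^ m) v = raySeq u k ∧
        ∀ t, 0 < t → t < m → 0 < latticeDet v ((S.rotation ^ t) v) ∧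
          0 < latticeDet ((S.rotation ^ t) v) (raySeq u k) := by
      rcases h with h | h
      · exact exists_rotation_pow _ _ h
      · exact exists_rotation_pow_of_eq_neg _ _ h
    have hseq : ∀ t : ℕ, (S.rotation ^ t) v = raySeq u (i + t) := fun t => by
      rw [raySeq_add]; simp [raySeq, v]
    simp only [hseq] at hm hmj
    have hmod := (raySeq_eq_iff u).mp hm
    -- The rotation from `f i` to `f k` stops before it has gone once around.
    have hmn : m < S.rays.card := by
      by_contra hc
      rcases eq_or_lt_of_le (not_lt.mp hc) with he | hlt
      · have h1 : raySeq u (i + m) = raySeq u i := (raySeq_eq_iff u).mpr (by rw [← he]; simp)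
        rw [h1, raySeq_eq_iff, Int.modEq_iff_dvd] at hm
        have := Int.le_of_dvd (by omega) hm
        omega
      · have h1 : raySeq u (i + S.rays.card) = raySeq u i := (raySeq_eq_iff u).mpr (by simp)
        have := (hmj S.rays.card (Finset.card_pos.mpr ⟨u, u.2⟩) hlt).1
        rw [h1, ← hv, latticeDet_self] at this
        omega
    have hmk : i + m = k := by
      rw [Int.modEq_iff_dvd] at hmod
      have := Int.eq_zero_of_abs_lt_dvd hmod (by rw [abs_lt]; omega)
      omega
    have := hmj (j - i).toNat (by omega) (by omega)
    rwa [show i + ((j - i).toNat : ℤ) = j by omega] at this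

/-- The number of torus-invariant curves with self-intersection number at least `-1`. -/
noncomputable def freeCount (S : CompleteToricSurface) : ℕ :=
  (Finset.univ.filter fun u : S.rays => -1 ≤ S.selfInt u).card

theorem atMostThreeFree (h : S.freeCount ≤ 3) (u : S.rays) :
    AtMostThreeFree S.rays.card (fun i => S.selfInt (raySeq u i)) := by
  classical
  intro i j k l hij hjk hkl hli hi hj hk hl
  have hne : ∀ s t : ℤ, s < t → t < s + S.rays.card → raySeq u s ≠ raySeq u t := by
    intro s t h1 h2 h3
    rw [raySeq_eq_iff, Int.modEq_iff_dvd] at h3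
    have := Int.le_of_dvd (by omega) h3
    omega
  have h4 : ({raySeq u i, raySeq u j, raySeq u k, raySeq u l} : Finset S.rays).card = 4 :=
    Finset.card_eq_of_equiv_fin (Fintype.equivFinOfCardEq (by
      rw [Fintype.card_coe, Finset.card_insert_of_notMem, Finset.card_insert_of_notMem,
        Finset.card_insert_of_notMem, Finset.card_singleton] <;>
      simp [hne i j hij (by omega), hne i k (by omega) (by omega), hne i l (by omega) (by omega),
        hne j k hjk (by omega), hne j l (by omega) (by omega), hne k l hkl (by omega)]))
  have hsub : ({raySeq u i, raySeq u j, raySeq u k, raySeq u l} : Finset S.rays) ⊆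
      Finset.univ.filter fun u : S.rays => -1 ≤ S.selfInt u := by
    intro v hv
    simp only [Finset.mem_insert, Finset.mem_singleton] at hv
    rw [Finset.mem_filter]
    refine ⟨Finset.mem_univ _, ?_⟩
    rcases hv with rfl | rfl | rfl | rfl <;> assumption
  have := Finset.card_le_card hsub
  unfold freeCount at h
  omega

theorem hasDualCycle_of_isCycleOf (u : S.rays) {l : List ℤ}
    (h : IsCycleOf S.rays.card (fun i => S.selfInt (raySeq u i)) l) (hl : 2 ≤ l.length) :
    S.HasDualCycle l := by
  obtain ⟨hn, c, ε, hε, hget⟩ := h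
  have hεε : ε * ε = 1 := by rcases hε with rfl | rfl <;> rfl
  have hinj : Function.Injective fun i : Fin l.length => raySeq u (c + ε * i) := by
    intro i j hij
    simp only at hij
    rw [raySeq_eq_iff, hn, Int.modEq_iff_dvd] at hij
    have h1 : (l.length : ℤ) ∣ (j : ℤ) - i := by
      have := hij.mul_left ε
      rwa [show ε * (c + ε * j - (c + ε * i)) = ε * ε * (j - i) by ring, hεε, one_mul] at this
    have := i.2
    have := j.2
    have := Int.eq_zero_of_abs_lt_dvd h1 (by rw [abs_lt]; omega)
    exact Fin.ext (by omega)
  have hbij := (Fintype.bijective_iff_injective_and_card _).mpr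
    ⟨hinj, by rw [Fintype.card_fin, Fintype.card_coe, hn]⟩
  have hfin : ∀ i j : Fin l.length, (i - j).val = 1 ↔ (j : ℤ) + 1 ≡ i [ZMOD l.length] := by
    intro i j
    have hj := j.2
    rw [Fin.val_sub]
    have h1 : (l.length - j.val + i.val) % l.length = 1 ↔
        (l.length - j.val + i.val) ≡ 1 [MOD l.length] := by
      rw [Nat.ModEq, Nat.mod_eq_of_lt (a := 1) (by omega)]
    rw [h1, ← Int.natCast_modEq_iff, Int.modEq_iff_dvd, Int.modEq_iff_dvd]
    push_cast [hj.le]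
    rw [show (1 : ℤ) - (l.length - j + i) = -(i - (j + 1)) - l.length by ring,
      dvd_sub_self_right, dvd_neg]
  refine ⟨⟨Equiv.ofBijective _ hbij, ?_⟩, fun i => hget i⟩
  intro i j
  rw [SimpleGraph.cycleGraph_adj', hfin, hfin]
  change S.IsCone (raySeq u (c + ε * i)) (raySeq u (c + ε * j)) ∨
    S.IsCone (raySeq u (c + ε * j)) (raySeq u (c + ε * i)) ↔ _
  rw [isCone_raySeq_iff, isCone_raySeq_iff, hn]
  simp only [Int.modEq_iff_dvd]
  rcases hε with rfl | rfl
  · rw [show c + 1 * (j : ℤ) - (c + 1 * i + 1) = j - (i + 1) by ring,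
      show c + 1 * (i : ℤ) - (c + 1 * j + 1) = i - (j + 1) by ring]
    exact or_comm
  · rw [show c + -1 * (j : ℤ) - (c + -1 * i + 1) = i - (j + 1) by ring,
      show c + -1 * (i : ℤ) - (c + -1 * j + 1) = j - (i + 1) by ring]

/-- One of the surfaces at which the cascades start. -/
def IsStandard (S : CompleteToricSurface) : Prop :=
  (∃ n : ℤ, 2 ≤ n ∧ S.IsStdOne n) ∨ (∃ n : ℤ, 2 ≤ n ∧ S.IsStdTwo n) ∨ S.IsThreeATwo

theorem isStandard_of_isCycleOf (hS : S.IsSmooth) (u : S.rays) {l : List ℤ}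
    (hl : IsStandardCycle l) (h : IsCycleOf S.rays.card (fun i => S.selfInt (raySeq u i)) l) :
    S.IsStandard := by
  rcases hl with ⟨m, hm, rfl⟩ | ⟨m, hm, rfl⟩ | rfl
  · exact Or.inl ⟨m, hm, hS, hasDualCycle_of_isCycleOf u h (by simp [fiberTypeOne])⟩
  · exact Or.inr (Or.inl ⟨m, hm, hS, hasDualCycle_of_isCycleOf u h (by simp [fiberTypeOne])⟩)
  · exact Or.inr (Or.inr ⟨hS, hasDualCycle_of_isCycleOf u h (by simp [fiberTypeOne])⟩)

/-! ### Contraction of a `(-1)`-curve -/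

section Contraction

variable {p u q : S.rays}

theorem add_eq_of_selfInt (hS : S.IsSmooth) (hp : S.IsCone p u) (hq : S.IsCone u q)
    (hu : S.selfInt u = -1) : (p : ℤ × ℤ) + q = u := by
  rw [IsCone.sum_eq hS hp hq, hu]
  simp

theorem IsCone.not_swap {v w : S.rays} (h : S.IsCone v w) : ¬ S.IsCone w v := by
  intro h'
  have := latticeDet_swap (v : ℤ × ℤ) w
  have := h.1
  have := h'.1
  omega

theorem IsCone.ne {v w : S.rays} (h : S.IsCone v w) : v ≠ w := by
  rintro rfl
  exact h.not_swap h

/-- The fan without the ray of a `(-1)`-curve. -/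
noncomputable def contraction (hS : S.IsSmooth) (hp : S.IsCone p u) (hq : S.IsCone u q)
    (hu : S.selfInt u = -1) : CompleteToricSurface where
  rays := S.rays.erase u
  primitive v hv := S.primitive v (Finset.mem_of_mem_erase hv)
  complete m hm := by
    obtain ⟨v, hv, hmv⟩ := S.complete m hm
    by_cases hvu : v = u
    · subst hvu
      have e := add_eq_of_selfInt hS hp hq hu
      have hsum : 0 < latticePairing m p + latticePairing m q := by
        rw [← e] at hmv
        simp only [latticePairing, Prod.fst_add, Prod.snd_add] at hmv ⊢
        linarith
      by_cases h1 : 0 < latticePairing m p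
      · exact ⟨p, Finset.mem_erase.mpr ⟨fun hh => hp.ne (Subtype.ext hh), p.2⟩, h1⟩
      · exact ⟨q, Finset.mem_erase.mpr ⟨fun hh => hq.ne (Subtype.ext hh.symm), q.2⟩, by omega⟩
    · exact ⟨v, Finset.mem_erase.mpr ⟨hvu, hv⟩, hmv⟩

variable {hS : S.IsSmooth} {hp : S.IsCone p u} {hq : S.IsCone u q} {hu : S.selfInt u = -1}

theorem contraction_rays : (contraction hS hp hq hu).rays = S.rays.erase u := rfl

/-- A ray of the contraction as a ray of the surface. -/
def ofContraction (v : (contraction hS hp hq hu).rays) : S.rays :=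
  ⟨v, Finset.mem_of_mem_erase v.2⟩

/-- A ray of the surface, other than the contracted one, as a ray of the contraction. -/
def toContraction (hS : S.IsSmooth) (hp : S.IsCone p u) (hq : S.IsCone u q)
    (hu : S.selfInt u = -1) (v : S.rays) (hv : v ≠ u) : (contraction hS hp hq hu).rays :=
  ⟨v, by rw [contraction_rays, Finset.mem_erase]; exact ⟨fun h => hv (Subtype.ext h), v.2⟩⟩

theorem ofContraction_ne (v : (contraction hS hp hq hu).rays) : ofContraction v ≠ u := by
  have h : (v : ℤ × ℤ) ∈ S.rays.erase u := v.2
  exact fun hh => (Finset.mem_erase.mp h).1 (congrArg Subtype.val hh)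

theorem isCone_contraction_of_isCone {v w : (contraction hS hp hq hu).rays}
    (h : S.IsCone (ofContraction v) (ofContraction w)) : (contraction hS hp hq hu).IsCone v w :=
  ⟨h.1, fun x => h.2 (ofContraction x)⟩

theorem isCone_contraction {v w : (contraction hS hp hq hu).rays} (hv : ofContraction v = p)
    (hw : ofContraction w = q) : (contraction hS hp hq hu).IsCone v w := by
  have hv' : (v : ℤ × ℤ) = p := congrArg Subtype.val hv
  have hw' : (w : ℤ × ℤ) = q := congrArg Subtype.val hw
  have e := add_eq_of_selfInt hS hp hq hu
  have hpu := hS _ _ hp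
  have hpq : latticeDet p q = 1 := by
    rw [← e, latticeDet_add_right, latticeDet_self] at hpu
    omega
  refine ⟨by rw [hv', hw', hpq]; exact one_pos, fun x hx => ?_⟩
  rw [hv', hw'] at hx
  have h1 := hp.2 (ofContraction x)
  have h2 := hq.2 (ofContraction x)
  change ¬(0 < latticeDet p x ∧ 0 < latticeDet x u) at h1
  change ¬(0 < latticeDet u x ∧ 0 < latticeDet x q) at h2
  have h3 := latticeDet_swap (x : ℤ × ℤ) u
  have h4 : latticeDet x u = 0 := by
    have : ¬ 0 < latticeDet x u := fun h => h1 ⟨hx.1, h⟩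
    have : ¬ 0 < latticeDet u x := fun h => h2 ⟨h, hx.2⟩
    omega
  refine ofContraction_ne x (Subtype.ext ?_)
  exact (eq_of_latticeDet_eq_zero (isCoprime_ray (ofContraction x)) (isCoprime_ray u) h4 hx.1
    hp.1).symm

theorem isCone_of_isCone_contraction {v w : (contraction hS hp hq hu).rays}
    (h : (contraction hS hp hq hu).IsCone v w) :
    S.IsCone (ofContraction v) (ofContraction w) ∨ (ofContraction v = p ∧ ofContraction w = q) := by
  obtain ⟨x, hx⟩ := exists_isCone (ofContraction v)
  by_cases hxu : x = u
  · subst hxu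
    have hvp := hx.left_unique hp
    have := isCone_contraction (hS := hS) (hu := hu) (v := v)
      (w := toContraction hS hp hq hu q hq.ne.symm) hvp rfl
    exact Or.inr ⟨hvp, by rw [h.right_unique this]; rfl⟩
  · have := isCone_contraction_of_isCone (hS := hS) (hp := hp) (hq := hq) (hu := hu) (v := v)
      (w := toContraction hS hp hq hu x hxu) hx
    rw [h.right_unique this]
    exact Or.inl hx

theorem isSmooth_contraction : (contraction hS hp hq hu).IsSmooth := by
  intro v w h
  rcases isCone_of_isCone_contraction h with h | ⟨h1, h2⟩
  · exact hS _ _ h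
  · have e := add_eq_of_selfInt hS hp hq hu
    have hpu := hS _ _ hp
    rw [← e, latticeDet_add_right, latticeDet_self] at hpu
    rw [show (v : ℤ × ℤ) = p from congrArg Subtype.val h1,
      show (w : ℤ × ℤ) = q from congrArg Subtype.val h2]
    omega

theorem selfInt_contraction_left {v : (contraction hS hp hq hu).rays} (hv : ofContraction v = p) :
    (contraction hS hp hq hu).selfInt v = S.selfInt p + 1 := by
  obtain ⟨r, hr⟩ := exists_isCone_left p
  have hru : r ≠ u := fun h => hp.not_swap (h ▸ hr)
  have h1 := isCone_contraction_of_isCone (hS := hS) (hp := hp) (hq := hq) (hu := hu)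
    (v := toContraction hS hp hq hu r hru) (w := v) (by rw [hv]; exact hr)
  have h2 := isCone_contraction (hS := hS) (hp := hp) (hq := hq) (hu := hu) (v := v)
    (w := toContraction hS hp hq hu q hq.ne.symm) hv rfl
  refine IsCone.selfInt_eq isSmooth_contraction h1 h2 ?_
  have e1 := IsCone.sum_eq hS hr hp
  have e2 := add_eq_of_selfInt hS hp hq hu
  rw [show (v : ℤ × ℤ) = p from congrArg Subtype.val hv]
  change (r : ℤ × ℤ) + q = _
  linear_combination (exp := 1) e1 + e2

theorem selfInt_contraction_right {v : (contraction hS hp hq hu).rays}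
    (hv : ofContraction v = q) : (contraction hS hp hq hu).selfInt v = S.selfInt q + 1 := by
  obtain ⟨r, hr⟩ := exists_isCone q
  have hru : r ≠ u := fun h => hq.not_swap (h ▸ hr)
  have h1 := isCone_contraction_of_isCone (hS := hS) (hp := hp) (hq := hq) (hu := hu)
    (v := v) (w := toContraction hS hp hq hu r hru) (by rw [hv]; exact hr)
  have h2 := isCone_contraction (hS := hS) (hp := hp) (hq := hq) (hu := hu)
    (v := toContraction hS hp hq hu p hp.ne) (w := v) rfl hv
  refine IsCone.selfInt_eq isSmooth_contraction h2 h1 ?_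
  have e1 := IsCone.sum_eq hS hq hr
  have e2 := add_eq_of_selfInt hS hp hq hu
  rw [show (v : ℤ × ℤ) = q from congrArg Subtype.val hv]
  change (p : ℤ × ℤ) + r = _
  linear_combination (exp := 1) e1 + e2

theorem selfInt_contraction_of_ne {v : (contraction hS hp hq hu).rays} (hvp : ofContraction v ≠ p)
    (hvq : ofContraction v ≠ q) :
    (contraction hS hp hq hu).selfInt v = S.selfInt (ofContraction v) := by
  obtain ⟨r, hr⟩ := exists_isCone_left (ofContraction v)
  obtain ⟨s, hs⟩ := exists_isCone (ofContraction v)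
  have hru : r ≠ u := by
    rintro rfl
    exact hvq (hr.right_unique hq)
  have hsu : s ≠ u := by
    rintro rfl
    exact hvp (hs.left_unique hp)
  have h1 := isCone_contraction_of_isCone (hS := hS) (hp := hp) (hq := hq) (hu := hu)
    (v := toContraction hS hp hq hu r hru) (w := v) hr
  have h2 := isCone_contraction_of_isCone (hS := hS) (hp := hp) (hq := hq) (hu := hu)
    (v := v) (w := toContraction hS hp hq hu s hsu) hs
  exact IsCone.selfInt_eq isSmooth_contraction h1 h2 (IsCone.sum_eq hS hr hs)

theorem freeCount_contraction_le {E D : S.rays}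
    (hED : E = p ∧ D = q ∨ E = q ∧ D = p) (hD : S.selfInt D ≤ -3) :
    (contraction hS hp hq hu).freeCount ≤ S.freeCount := by
  classical
  -- The curve `E` takes the place of the contracted curve.
  refine Finset.card_le_card_of_injOn
    (fun v => if ofContraction v = E then u else ofContraction v) ?_ ?_
  · intro v hv
    simp only [Finset.coe_filter, Finset.mem_univ, true_and, Set.mem_ofPred_eq] at hv ⊢
    split_ifs with hE
    · exact hu.ge
    · have hvD : ofContraction v ≠ D := by
        intro hvD
        have : (contraction hS hp hq hu).selfInt v = S.selfInt D + 1 := by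
          rcases hED with ⟨-, rfl⟩ | ⟨-, rfl⟩
          · exact selfInt_contraction_right hvD
          · exact selfInt_contraction_left hvD
        omega
      rwa [← selfInt_contraction_of_ne]
      · rcases hED with ⟨rfl, -⟩ | ⟨-, rfl⟩ <;> assumption
      · rcases hED with ⟨-, rfl⟩ | ⟨rfl, -⟩ <;> assumption
  · intro v _ w _ hvw
    have key : ofContraction v = ofContraction w := by
      simp only at hvw
      split_ifs at hvw with h1 h2 h2
      · rw [h1, h2]
      · exact absurd hvw.symm (ofContraction_ne w)
      · exact absurd hvw (ofContraction_ne v)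
      · exact hvw
    have := congrArg Subtype.val key
    exact Subtype.ext this

end Contraction

/-- The contraction of a `(-1)`-curve `C` between a `(-2)`-curve `E` and a curve `D` with
`D² ≤ -3`: then `E` becomes a `(-1)`-curve that meets `D`. -/
theorem exists_inverseCascadeStep (hS : S.IsSmooth) {p u q : S.rays} (hp : S.IsCone p u)
    (hq : S.IsCone u q) (hu : S.selfInt u = -1) {E D : S.rays}
    (hED : E = p ∧ D = q ∨ E = q ∧ D = p) (hE : S.selfInt E = -2) (hD : S.selfInt D ≤ -3) :
    ∃ T : CompleteToricSurface, T.rays.card < S.rays.card ∧ T.IsSmooth ∧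
      T.freeCount ≤ S.freeCount ∧ InverseCascadeStep T S ∧
      ∃ C' D' : T.rays, T.selfInt C' = -1 ∧ T.selfInt D' ≤ -2 ∧ T.dualGraph.Adj C' D' := by
  classical
  set T := contraction hS hp hq hu with hT
  set p' := toContraction hS hp hq hu p hp.ne
  set q' := toContraction hS hp hq hu q hq.ne.symm
  have hcone : T.IsCone p' q' := isCone_contraction rfl rfl
  have hp' : T.selfInt p' = S.selfInt p + 1 := selfInt_contraction_left rfl
  have hq' : T.selfInt q' = S.selfInt q + 1 := selfInt_contraction_right rfl
  have e := add_eq_of_selfInt hS hp hq hu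
  have hrays : S.rays = insert (u : ℤ × ℤ) T.rays := by
    rw [hT, contraction_rays, Finset.insert_erase u.2]
  obtain ⟨C', D', h1, h2, h3, h4⟩ : ∃ C' D' : T.rays, T.selfInt C' = -1 ∧ T.selfInt D' ≤ -2 ∧
      T.dualGraph.Adj C' D' ∧ (C' : ℤ × ℤ) + D' = u := by
    rcases hED with ⟨rfl, rfl⟩ | ⟨rfl, rfl⟩
    · exact ⟨p', q', by omega, by omega, Or.inl hcone, e⟩
    · exact ⟨q', p', by omega, by omega, Or.inr hcone, by rw [add_comm]; exact e⟩
  refine ⟨T, ?_, isSmooth_contraction, freeCount_contraction_le hED hD,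
    ⟨C', D', h1, h2, isSmooth_contraction, h3, ?_⟩, C', D', h1, h2, h3⟩
  · rw [hT, contraction_rays]
    exact Finset.card_erase_lt_of_mem u.2
  · rw [h4]
    exact hrays

/-- Repeated contraction leads to one of the standard surfaces. -/
theorem exists_cascade (S : CompleteToricSurface) (hS : S.IsSmooth) (hfree : S.freeCount ≤ 3)
    {C D : S.rays} (hC : S.selfInt C = -1) (hD : S.selfInt D ≤ -2) (hCD : S.dualGraph.Adj C D) :
    ∃ S₀ : CompleteToricSurface, S₀.IsStandard ∧
      Relation.ReflTransGen InverseCascadeStep S₀ S := by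
  induction hN : S.rays.card using Nat.strong_induction_on generalizing S with
  | _ N ih =>
    have hcyc := cyclicFan hS C
    by_cases hc : NotContractible fun i => S.selfInt (raySeq C i)
    · have hadj : S.selfInt (raySeq C (0 - 1)) ≤ -2 ∨ S.selfInt (raySeq C (0 + 1)) ≤ -2 := by
        have h1 := isCone_raySeq C 0
        have h2 := isCone_raySeq C (0 - 1)
        rw [raySeq_zero] at h1
        rw [sub_add_cancel, raySeq_zero] at h2
        rcases hCD with h | h
        · right
          rwa [h1.right_unique h]
        · left
          rwa [h2.left_unique h]
      obtain ⟨l, hl, hl'⟩ := hcyc.isCycle_of_notContractible (atMostThreeFree hfree C) hc (i := 0)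
        hC hadj
      exact ⟨S, isStandard_of_isCycleOf hS C hl hl', .refl⟩
    · have hstep : ∃ T : CompleteToricSurface, T.rays.card < S.rays.card ∧ T.IsSmooth ∧
          T.freeCount ≤ S.freeCount ∧ InverseCascadeStep T S ∧
          ∃ C' D' : T.rays, T.selfInt C' = -1 ∧ T.selfInt D' ≤ -2 ∧ T.dualGraph.Adj C' D' := by
        unfold NotContractible at hc
        push Not at hc
        obtain ⟨i, hi, hc⟩ := hc
        have h1 := isCone_raySeq C (i - 1)
        rw [sub_add_cancel] at h1
        by_cases h2 : S.selfInt (raySeq C (i - 1)) = -2 ∧ S.selfInt (raySeq C (i + 1)) < -2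
        · exact exists_inverseCascadeStep hS h1 (isCone_raySeq C i) hi (Or.inl ⟨rfl, rfl⟩) h2.1
            (by omega)
        · obtain ⟨h3, h4⟩ := hc fun h => not_lt.mp fun h' => h2 ⟨h, h'⟩
          exact exists_inverseCascadeStep hS h1 (isCone_raySeq C i) hi (Or.inr ⟨rfl, rfl⟩) h3
            (by omega)
      obtain ⟨T, hlt, hT, hTfree, hTS, C', D', h1, h2, h3⟩ := hstep
      obtain ⟨S₀, hS₀, hcas⟩ := ih _ (hN ▸ hlt) T hT (hTfree.trans hfree) h1 h2 h3 rfl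
      exact ⟨S₀, hS₀, hcas.tail hTS⟩

/-! ### The Picard number -/

theorem card_rays_le_of_picardNumber (S : CompleteToricSurface) :
    S.rays.card ≤ S.picardNumber + 2 := by
  classical
  have hle : LinearMap.range S.divChar ≤ S.cartierDivisors := by
    rintro _ ⟨m, rfl⟩ u v _
    exact ⟨m, rfl, rfl⟩
  have h1 : Module.finrank ℤ S.PicardGroup +
      Module.finrank ℤ ((LinearMap.range S.divChar).submoduleOf S.cartierDivisors) =
        Module.finrank ℤ S.cartierDivisors := Submodule.finrank_quotient_add_finrank _
  have h2 : Module.finrank ℤ ((LinearMap.range S.divChar).submoduleOf S.cartierDivisors) ≤ 2 := by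
    rw [(Submodule.submoduleOfEquivOfLe hle).finrank_eq]
    refine (LinearMap.finrank_range_le _).trans ?_
    simp
  -- A multiple `N D` of a Weil divisor is Cartier if all the determinants of cones divide `N`.
  have h3 : S.rays.card ≤ Module.finrank ℤ S.cartierDivisors := by
    set N : ℤ := ∏ x : S.rays × S.rays,
      if latticeDet x.1 x.2 = 0 then 1 else latticeDet x.1 x.2 with hN
    have hN0 : N ≠ 0 := by
      rw [hN, Finset.prod_ne_zero_iff]
      intro x _
      split_ifs with h
      · exact one_ne_zero
      · exact h
    have hmem : ∀ D : S.WeilDivisor, N • D ∈ S.cartierDivisors := by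
      intro D u v huv
      have hdvd : latticeDet u v ∣ N := by
        have := Finset.dvd_prod_of_mem (fun x : S.rays × S.rays =>
          if latticeDet x.1 x.2 = 0 then 1 else latticeDet x.1 x.2) (Finset.mem_univ (u, v))
        simp only [if_neg huv.1.ne'] at this
        exact this
      obtain ⟨c, hc⟩ := hdvd
      refine ⟨(c * (D u * (v : ℤ × ℤ).2 - D v * (u : ℤ × ℤ).2),
        c * (D v * (u : ℤ × ℤ).1 - D u * (v : ℤ × ℤ).1)), ?_, ?_⟩ <;>
      · simp only [divChar, LinearMap.coe_mk, AddHom.coe_mk, latticePairing, Pi.smul_apply,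
          smul_eq_mul, hc, latticeDet]
        ring
    have := LinearMap.finrank_le_finrank_of_injective
      (f := ((N • LinearMap.id : S.WeilDivisor →ₗ[ℤ] S.WeilDivisor).codRestrict
        S.cartierDivisors hmem)) (by
        intro D D' h
        have h' := congrArg Subtype.val h
        exact smul_right_injective _ hN0 h')
    rwa [Module.finrank_fintype_fun_eq_card, Fintype.card_coe] at this
  unfold picardNumber
  omega

/-! ### The minimal resolution -/

/-- An exceptional curve of the minimal resolution has self-intersection number at most `-2`: the
cone spanned by its neighbors contains no ray of `S`, hence its angle is less than `π`. -/
theorem IsMinimalResolution.selfInt_le {S S' : CompleteToricSurface}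
    (h : S'.IsMinimalResolution S) {u : S'.rays} (hu : (u : ℤ × ℤ) ∉ S.rays) :
    S'.selfInt u ≤ -2 := by
  obtain ⟨hsm, hsub, hne⟩ := h
  obtain ⟨p, hp⟩ := exists_isCone_left u
  obtain ⟨q, hq⟩ := exists_isCone u
  have hsum := IsCone.sum_eq hsm hp hq
  by_contra hc
  have hb : 0 ≤ S'.selfInt u := by
    have := hne u hu
    omega
  obtain ⟨w, hw⟩ := exists_latticeDet_pos (S := S) (ray_ne_zero p)
  set w' : S'.rays := ⟨w, hsub w.2⟩
  have hwu : 0 < latticeDet u w := by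
    have h1 := hp.2 w'
    have h2 := latticeDet_swap (u : ℤ × ℤ) w
    by_contra hc
    have h3 : ¬ 0 < latticeDet w u := fun hh => h1 ⟨hw, hh⟩
    have h4 : (w : ℤ × ℤ) = u :=
      eq_of_latticeDet_eq_zero (isCoprime_ray u) (isCoprime_ray w) (by omega) hp.1 hw
    exact hu (h4 ▸ w.2)
  have hwq : ¬ 0 < latticeDet w q := fun hh => hq.2 w' ⟨hwu, hh⟩
  have h1 : latticeDet w ((p : ℤ × ℤ) + q) = S'.selfInt u * latticeDet u w := by
    rw [hsum, latticeDet_smul_right, latticeDet_swap (u : ℤ × ℤ) w]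
    ring
  rw [latticeDet_add_right, latticeDet_swap (p : ℤ × ℤ) w] at h1
  have := mul_nonneg hb hwu.le
  omega

theorem IsMinimalResolution.freeCount_le {S S' : CompleteToricSurface}
    (h : S'.IsMinimalResolution S) : S'.freeCount ≤ S.rays.card := by
  refine Finset.card_le_card_of_injOn (fun u => (u : ℤ × ℤ)) ?_ Subtype.val_injective.injOn
  intro u hu
  simp only [Finset.coe_filter, Finset.mem_univ, true_and, Set.mem_ofPred_eq] at hu
  by_contra hc
  have := h.selfInt_le hc
  omega

end CompleteToricSurface

theorem mainTheorem2 (S S' : CompleteToricSurface)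
    (hS : S.IsLogDelPezzo) (hrho : S.picardNumber = 1) (hbasic : ¬ S.IsBasic)
    (hS' : S'.IsMinimalResolution S) :
    ∃ S₀ : CompleteToricSurface,
      ((∃ n : ℤ, 2 ≤ n ∧ S₀.IsStdOne n) ∨ (∃ n : ℤ, 2 ≤ n ∧ S₀.IsStdTwo n) ∨
        S₀.IsThreeATwo) ∧
      Relation.ReflTransGen CompleteToricSurface.InverseCascadeStep S₀ S' := by
  unfold CompleteToricSurface.IsBasic at hbasic
  push Not at hbasic
  obtain ⟨C, D, hC, hCD, hD⟩ := hbasic S' hS'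
  have h1 := S.card_rays_le_of_picardNumber
  have h2 := hS'.freeCount_le
  exact S'.exists_cascade hS'.1 (by omega) hC (by omega) hCD
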